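/- **The logic $\mathcal G$.** Simple types are built with $\to$ from base types and a type $o$ of formulas. Terms are simply typed $\lambda$-terms modulo $\alpha\beta\eta$-conversion, built from: variables, whose types do not contain $o$ (infinitely many of each such type); nominal constants (infinitely many at each of the types, not containing $o$, at which $\nabla$ is permitted, and none at other types); nonlogical constants without $o$ in their argument types; and the logical constants $\top,\bot,\wedge,\vee,\supset$, $\forall_\tau,\exists_\tau$ ($\tau$ without $o$), $\nabla_\tau$ ($\tau$ permitted), and $\unrhd$, which forms a formula $s\unrhd t$ from $s:\tau_1\to\cdots\to\tau_n\to\tau$ and $t:\tau$ (for whatever collection of types one admits here, e.g. all). Formulas are the terms of type $o$. The free variables of a term and its support ${\rm supp}(t)$ are the variables, resp. nominal constants, that occur in its normal form. A permutation $\pi$ is a type-preserving bijection of the nominal constants that moves finitely many; $\pi.t$ is its action on terms; $B\approx B'$ means $B=\pi.B'$ for some $\pi$. A substitution $\theta$ is a type-preserving map from variables to terms with finite domain ${\rm dom}\,\theta=\{x\mid\theta(x)\ne x\}$; ${\rm supp}(\theta)$ is the set of nominal constants in the supports of the terms $\theta(x)$, $x\in{\rm dom}\,\theta$; $B[\theta]$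 is ordinary capture-avoiding application. The *nominal capture avoiding application* $B\langle\theta\rangle$ is $(\pi.B)[\theta]$ for any permutation $\pi$ that maps ${\rm supp}(B)$ outside ${\rm supp}(\theta)$ (it is determined up to $\approx$, and any choice is acceptable); it is applied to the elements of multisets one by one. For a set $\Sigma$ of variables, $\Sigma\theta$ is $\Sigma\setminus{\rm dom}\,\theta$ together with all free variables of the terms $\theta(x)$, $x\in{\rm dom}\,\theta$. The nominal abstraction $s\unrhd t$ *holds* if $s=\lambda c_1\cdots\lambda c_n.t$ for some distinct nominal constants $c_i$; $\theta$ is a *solution* of $s\unrhd t$ if $(s\unrhd t)\langle\theta\rangle$ holds. Fix a definition: for each predicate constant $p$ at most one clause $\forall\vec x.\,p\,\vec x\triangleq B\,p\,\vec x$, possibly marked inductive ($\mu$) or co-inductive ($\nu$), whose body $B$ has neither free variables nor nominal constants. (No stratification is needed here.) A sequent $\Sigma:\Gamma\vdash C$ consists of a finite set $\Sigma$ of variables, a multiset $\Gamma$ of formulas and a formula $C$, all free variables of $\Gamma$ and $C$ being in $\Sigma$. The rules (all sequents in a proof being of this form) are: * *id*: $\Sigma:\Gamma,B\vdash B'$ if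 $B\approx B'$; *cut*: from $\Sigma:\Gamma\vdash B$ and $\Sigma:B,\Delta\vdash C$ infer $\Sigma:\Gamma,\Delta\vdash C$; contraction on the left; the usual intuitionistic left and right rules for $\wedge,\vee,\supset$, $\bot\mathcal L$ and $\top\mathcal R$. * $\forall\mathcal L$, $\exists\mathcal R$: instantiate with a term $t$ whose free variables are in $\Sigma$ (it may contain any constants). $\forall\mathcal R$: from $\Sigma,h:\Gamma\vdash B[h\,\vec c/x]$ infer $\Sigma:\Gamma\vdash\forall x.B$, where $h\notin\Sigma$ and $\vec c$ lists ${\rm supp}(B)$ without repetition; dually $\exists\mathcal L$. $\nabla\mathcal L$, $\nabla\mathcal R$: instantiate with a nominal constant $a\notin{\rm supp}(B)$. * $\unrhd\mathcal R$: $\Sigma:\Gamma\vdash s\unrhd t$ if $s\unrhd t$ holds. $\unrhd\mathcal L$: infer $\Sigma:\Gamma,s\unrhd t\vdash C$ from the premises $\Sigma\theta:\Gamma\langle\theta\rangle\vdash C\langle\theta\rangle$, one for each solution $\theta$ of $s\unrhd t$. * def$\mathcal L$, def$\mathcal R$: replace $p\,\vec t$ in the conclusion by $B\,p\,\vec t$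 in the premise. For $\mu$-clauses, $\mathcal{IL}$: from $\vec x:B\,S\,\vec x\vdash S\,\vec x$ and $\Sigma:\Gamma,S\,\vec t\vdash C$ infer $\Sigma:\Gamma,p\,\vec t\vdash C$; for $\nu$-clauses, $\mathcal{CIR}$: from $\Sigma:\Gamma\vdash S\,\vec t$ and $\vec x:S\,\vec x\vdash B\,S\,\vec x$ infer $\Sigma:\Gamma\vdash p\,\vec t$; here $\vec x$ are distinct variables and $S$ is a term of the type of $p$ without free variables and nominal constants. The height ${\rm ht}(\Pi)$ of a proof is the ordinal $1$ if $\Pi$ has no premise derivations, and otherwise the least upper bound of the ordinals ${\rm ht}(\Pi_i)+1$ for its premise derivations $\Pi_i$. **Lemma.** Let $\Pi$ be a proof of $\Sigma:\Gamma\vdash C$ and let $\theta$ be a substitution. Then values of $\Gamma\langle\theta\rangle$ and $C\langle\theta\rangle$ exist, and for every choice of these values there is a proof $\Pi'$ of $\Sigma\theta:\Gamma\langle\theta\rangle\vdash C\langle\theta\rangle$ with ${\rm ht}(\Pi')\le{\rm ht}(\Pi)$. -/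

import Mathlib

namespace NomAbs

noncomputable section

/-! ## Types, languages, variables, nominal constants -/

/-- Simple types over a collection `β` of base types; `o` is the type of formulas. -/
inductive SType (β : Type) : Type
  | base (b : β) : SType β
  | o : SType β
  | arr (σ τ : SType β) : SType β

/-- The type does not contain `o`. -/
def SType.OFree {β : Type} : SType β → Prop
  | .base _ => True
  | .o => False
  | .arr σ τ => σ.OFree ∧ τ.OFree

/-- `arrows [τ₁, …, τₙ] τ` is `τ₁ → ⋯ → τₙ → τ`. -/
def arrows {β : Type} : List (SType β) → SType β → SType β
  | [], τ => τ
  | σ :: ts, τ => .arr σ (arrows ts τ)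

/-- The vocabulary of the logic. The non-nominal nonlogical constants are split, according to the
target of their type, into `Fn ts b` (type `ts → b` with `b` a base type) and the predicate
constants `Pr ts` (type `ts → o`). -/
structure Lang where
  /-- base types other than `o` -/
  Base : Type
  /-- types at which nabla-quantification is permitted -/
  NabTy : SType Base → Prop
  nab_ofree : ∀ τ, NabTy τ → τ.OFree
  /-- types `τ₁, …, τₙ` and `τ` at which the nominal abstraction symbol may be used (for instance
  all types, or the types that do not contain `o`) -/
  NaTy : List (SType Base) → SType Base → Prop
  /-- nominal constants of each type -/
  Nom : SType Base → Type
  nom_infinite : ∀ τ, NabTy τ → Infinite (Nom τ)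
  nom_empty : ∀ τ, ¬ NabTy τ → IsEmpty (Nom τ)
  /-- nonlogical constants that are not predicates -/
  Fn : List (SType Base) → Base → Type
  fn_ofree : ∀ ts b, Fn ts b → ∀ σ ∈ ts, σ.OFree
  /-- predicate constants -/
  Pr : List (SType Base) → Type
  pr_ofree : ∀ ts, Pr ts → ∀ σ ∈ ts, σ.OFree

/-- The types of a language. -/
abbrev Lang.Ty (L : Lang) : Type := SType L.Base

/-- Variables of type `τ`; the types of variables do not contain `o`. -/
structure EVar {β : Type} (τ : SType β) : Type where
  name : ℕ
  ofree : τ.OFree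

/-- Variables of all types. -/
abbrev Lang.Var (L : Lang) : Type := Σ τ : L.Ty, EVar τ

/-- Nominal constants of all types. -/
abbrev Lang.Nominal (L : Lang) : Type := Σ τ : L.Ty, L.Nom τ

/-! ## Lambda-terms and lambda-conversion -/

/-- Constants other than the nominal ones, logical and nonlogical. -/
inductive Const (L : Lang) : L.Ty → Type
  | top : Const L .o
  | bot : Const L .o
  | and : Const L (.arr .o (.arr .o .o))
  | or : Const L (.arr .o (.arr .o .o))
  | imp : Const L (.arr .o (.arr .o .o))
  | all {τ : L.Ty} (h : τ.OFree) : Const L (.arr (.arr τ .o) .o)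
  | ex {τ : L.Ty} (h : τ.OFree) : Const L (.arr (.arr τ .o) .o)
  | nab {τ : L.Ty} (h : L.NabTy τ) : Const L (.arr (.arr τ .o) .o)
  | na {ts : List L.Ty} {τ : L.Ty} (h : L.NaTy ts τ) : Const L (.arr (arrows ts τ) (.arr τ .o))
  | fn {ts : List L.Ty} {b : L.Base} (f : L.Fn ts b) : Const L (arrows ts (.base b))
  | pr {ts : List L.Ty} (p : L.Pr ts) : Const L (arrows ts .o)

/-- Typed de Bruijn indices for lambda-bound variables. -/
inductive Mem {β : Type} : List (SType β) → SType β → Type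
  | here {Γ : List (SType β)} {τ : SType β} : Mem (τ :: Γ) τ
  | there {Γ : List (SType β)} {σ τ : SType β} (v : Mem Γ τ) : Mem (σ :: Γ) τ

/-- Simply typed lambda-terms, up to renaming of bound variables. The list holds the types of the
dangling de Bruijn indices; `fvar` are the (named) free variables. -/
inductive Raw (L : Lang) : List L.Ty → L.Ty → Type
  | bvar {Γ : List L.Ty} {τ : L.Ty} (v : Mem Γ τ) : Raw L Γ τ
  | fvar {Γ : List L.Ty} {τ : L.Ty} (x : EVar τ) : Raw L Γ τ
  | nom {Γ : List L.Ty} {τ : L.Ty} (a : L.Nom τ) : Raw L Γ τ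
  | const {Γ : List L.Ty} {τ : L.Ty} (c : Const L τ) : Raw L Γ τ
  | app {Γ : List L.Ty} {σ τ : L.Ty} (t : Raw L Γ (.arr σ τ)) (u : Raw L Γ σ) : Raw L Γ τ
  | lam {Γ : List L.Ty} {σ τ : L.Ty} (t : Raw L (σ :: Γ) τ) : Raw L Γ (.arr σ τ)

/-- The free variables that occur in a lambda-term. -/
def Raw.fvars {L : Lang} : {Γ : List L.Ty} → {τ : L.Ty} → Raw L Γ τ → Set L.Var
  | _, _, .bvar _ => ∅
  | _, _, .fvar x => {⟨_, x⟩}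
  | _, _, .nom _ => ∅
  | _, _, .const _ => ∅
  | _, _, .app t u => t.fvars ∪ u.fvars
  | _, _, .lam t => t.fvars

/-- The nominal constants that occur in a lambda-term. -/
def Raw.noms {L : Lang} : {Γ : List L.Ty} → {τ : L.Ty} → Raw L Γ τ → Set L.Nominal
  | _, _, .bvar _ => ∅
  | _, _, .fvar _ => ∅
  | _, _, .nom a => {⟨_, a⟩}
  | _, _, .const _ => ∅
  | _, _, .app t u => t.noms ∪ u.noms
  | _, _, .lam t => t.noms

/-- Renamings of de Bruijn indices. -/
abbrev Ren {β : Type} (Γ Δ : List (SType β)) : Type := ∀ τ, Mem Γ τ → Mem Δ τ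

/-- A renaming, extended under one binder. -/
def Ren.lift {β : Type} {Γ Δ : List (SType β)} (r : Ren Γ Δ) (σ : SType β) :
    Ren (σ :: Γ) (σ :: Δ)
  | _, .here => .here
  | _, .there v => .there (r _ v)

/-- The renaming that makes room for one more binder. -/
def Ren.shift {β : Type} {Γ : List (SType β)} (σ : SType β) : Ren Γ (σ :: Γ) :=
  fun _ v => .there v

/-- Renaming of de Bruijn indices in a term. -/
def Raw.ren {L : Lang} : {Γ Δ : List L.Ty} → {τ : L.Ty} → Ren Γ Δ → Raw L Γ τ → Raw L Δ τ
  | _, _, _, r, .bvar v => .bvar (r _ v)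
  | _, _, _, _, .fvar x => .fvar x
  | _, _, _, _, .nom a => .nom a
  | _, _, _, _, .const c => .const c
  | _, _, _, r, .app t u => .app (t.ren r) (u.ren r)
  | _, _, _, r, .lam t => .lam (t.ren (r.lift _))

/-- A simultaneous replacement for the dangling indices, the free variables and the nominal
constants of a term. -/
@[ext]
structure Env (L : Lang) (Γ Δ : List L.Ty) where
  bv : ∀ τ, Mem Γ τ → Raw L Δ τ
  fv : ∀ τ : L.Ty, EVar τ → Raw L Δ τ
  nm : ∀ τ, L.Nom τ → Raw L Δ τ

/-- Extension of the replacement of the dangling indices under one binder. -/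
def liftBv {L : Lang} {Γ Δ : List L.Ty} (f : ∀ τ, Mem Γ τ → Raw L Δ τ) (σ : L.Ty) :
    ∀ τ, Mem (σ :: Γ) τ → Raw L (σ :: Δ) τ
  | _, .here => .bvar .here
  | _, .there v => (f _ v).ren (Ren.shift σ)

/-- Extension of a replacement under one binder. -/
def Env.lift {L : Lang} {Γ Δ : List L.Ty} (e : Env L Γ Δ) (σ : L.Ty) :
    Env L (σ :: Γ) (σ :: Δ) where
  bv := liftBv e.bv σ
  fv := fun _ x => (e.fv _ x).ren (Ren.shift σ)
  nm := fun _ a => (e.nm _ a).ren (Ren.shift σ)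

/-- Capture-avoiding simultaneous replacement in a term. -/
def Raw.bind {L : Lang} : {Γ Δ : List L.Ty} → {τ : L.Ty} → Env L Γ Δ → Raw L Γ τ → Raw L Δ τ
  | _, _, _, e, .bvar v => e.bv _ v
  | _, _, _, e, .fvar x => e.fv _ x
  | _, _, _, e, .nom a => e.nm _ a
  | _, _, _, _, .const c => .const c
  | _, _, _, e, .app t u => .app (t.bind e) (u.bind e)
  | _, _, _, e, .lam t => .lam (t.bind (e.lift _))

/-- Replacement of the most recent dangling index by `u`. -/
def instBv {L : Lang} {Γ : List L.Ty} {σ : L.Ty} (u : Raw L Γ σ) :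
    ∀ τ, Mem (σ :: Γ) τ → Raw L Γ τ
  | _, .here => u
  | _, .there v => .bvar v

/-- The replacement that is used in contracting a beta-redex. -/
def Env.inst {L : Lang} {Γ : List L.Ty} {σ : L.Ty} (u : Raw L Γ σ) : Env L (σ :: Γ) Γ where
  bv := instBv u
  fv := fun _ x => .fvar x
  nm := fun _ a => .nom a

/-- Lambda-conversion (beta and eta; alpha is built into the representation). -/
inductive Conv {L : Lang} : {Γ : List L.Ty} → {τ : L.Ty} → Raw L Γ τ → Raw L Γ τ → Prop
  | refl {Γ : List L.Ty} {τ : L.Ty} (t : Raw L Γ τ) : Conv t t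
  | symm {Γ : List L.Ty} {τ : L.Ty} {t u : Raw L Γ τ} : Conv t u → Conv u t
  | trans {Γ : List L.Ty} {τ : L.Ty} {t u v : Raw L Γ τ} : Conv t u → Conv u v → Conv t v
  | app {Γ : List L.Ty} {σ τ : L.Ty} {t t' : Raw L Γ (.arr σ τ)} {u u' : Raw L Γ σ} :
      Conv t t' → Conv u u' → Conv (.app t u) (.app t' u')
  | lam {Γ : List L.Ty} {σ τ : L.Ty} {t t' : Raw L (σ :: Γ) τ} :
      Conv t t' → Conv (.lam t) (.lam t')
  | beta {Γ : List L.Ty} {σ τ : L.Ty} (t : Raw L (σ :: Γ) τ) (u : Raw L Γ σ) :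
      Conv (.app (.lam t) u) (t.bind (Env.inst u))
  | eta {Γ : List L.Ty} {σ τ : L.Ty} (t : Raw L Γ (.arr σ τ)) :
      Conv (.lam (.app (t.ren (Ren.shift σ)) (.bvar .here))) t

/-! ### Replacement respects conversion -/

theorem Raw.ren_ren {L : Lang} {Γ Δ Θ : List L.Ty} {τ : L.Ty} (t : Raw L Γ τ) (r : Ren Γ Δ)
    (s : Ren Δ Θ) : (t.ren r).ren s = t.ren (fun τ v => s τ (r τ v)) := by
  induction t generalizing Δ Θ with
  | lam t ih =>
    simp only [Raw.ren, ih]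
    congr 2
    funext τ v
    cases v <;> rfl
  | app t u iht ihu => simp only [Raw.ren, iht, ihu]
  | _ => rfl

theorem Raw.bind_ren {L : Lang} {Γ Δ Θ : List L.Ty} {τ : L.Ty} (t : Raw L Γ τ) (r : Ren Γ Δ)
    (e : Env L Δ Θ) :
    (t.ren r).bind e = t.bind ⟨fun τ v => e.bv τ (r τ v), e.fv, e.nm⟩ := by
  induction t generalizing Δ Θ with
  | lam t ih =>
    simp only [Raw.ren, Raw.bind, ih]
    congr 2
    apply Env.ext
    · funext τ v
      cases v <;> rfl
    · rfl
    · rfl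
  | app t u iht ihu => simp only [Raw.ren, Raw.bind, iht, ihu]
  | _ => rfl

theorem Raw.ren_bind {L : Lang} {Γ Δ Θ : List L.Ty} {τ : L.Ty} (t : Raw L Γ τ) (e : Env L Γ Δ)
    (r : Ren Δ Θ) :
    (t.bind e).ren r = t.bind ⟨fun τ v => (e.bv τ v).ren r, fun τ x => (e.fv τ x).ren r,
      fun τ a => (e.nm τ a).ren r⟩ := by
  induction t generalizing Δ Θ with
  | lam t ih =>
    simp only [Raw.ren, Raw.bind, ih]
    congr 2
    apply Env.ext
    · funext τ v
      cases v with
      | here => rfl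
      | there v => simp only [Env.lift, liftBv, Raw.ren_ren]; rfl
    · funext τ x
      simp only [Env.lift, Raw.ren_ren]; rfl
    · funext τ a
      simp only [Env.lift, Raw.ren_ren]; rfl
  | app t u iht ihu => simp only [Raw.ren, Raw.bind, iht, ihu]
  | _ => rfl

theorem Raw.bind_shift {L : Lang} {Γ Δ : List L.Ty} {σ τ : L.Ty} (t : Raw L Γ τ)
    (e : Env L Γ Δ) :
    (t.ren (Ren.shift σ)).bind (e.lift σ) = (t.bind e).ren (Ren.shift σ) := by
  rw [Raw.bind_ren, Raw.ren_bind]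
  rfl

theorem Raw.bind_bind {L : Lang} {Γ Δ Θ : List L.Ty} {τ : L.Ty} (t : Raw L Γ τ) (e : Env L Γ Δ)
    (f : Env L Δ Θ) :
    (t.bind e).bind f = t.bind ⟨fun τ v => (e.bv τ v).bind f, fun τ x => (e.fv τ x).bind f,
      fun τ a => (e.nm τ a).bind f⟩ := by
  induction t generalizing Δ Θ with
  | lam t ih =>
    simp only [Raw.bind, ih]
    congr 2
    apply Env.ext
    · funext τ v
      cases v with
      | here => rfl
      | there v => simp only [Env.lift, liftBv]; exact Raw.bind_shift _ _
    · funext τ x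
      exact Raw.bind_shift _ _
    · funext τ a
      exact Raw.bind_shift _ _
  | app t u iht ihu => simp only [Raw.bind, iht, ihu]
  | _ => rfl

theorem Raw.bind_id {L : Lang} {Γ : List L.Ty} {τ : L.Ty} (t : Raw L Γ τ) :
    t.bind ⟨fun _ v => .bvar v, fun _ x => .fvar x, fun _ a => .nom a⟩ = t := by
  induction t with
  | @lam Γ σ τ t ih =>
    simp only [Raw.bind]
    congr 1
    refine Eq.trans ?_ ih
    congr 1
    apply Env.ext
    · funext τ v
      cases v <;> rfl
    · rfl
    · rfl
  | app t u iht ihu => simp only [Raw.bind, iht, ihu]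
  | _ => rfl

theorem Raw.inst_shift {L : Lang} {Γ : List L.Ty} {σ τ : L.Ty} (t : Raw L Γ τ) (u : Raw L Γ σ) :
    (t.ren (Ren.shift σ)).bind (Env.inst u) = t := by
  rw [Raw.bind_ren]
  exact Raw.bind_id t

theorem Conv.bind {L : Lang} {Γ Δ : List L.Ty} {τ : L.Ty} {t u : Raw L Γ τ} (h : Conv t u)
    (e : Env L Γ Δ) : Conv (t.bind e) (u.bind e) := by
  induction h generalizing Δ with
  | refl t => exact .refl _
  | symm _ ih => exact .symm (ih e)
  | trans _ _ ih₁ ih₂ => exact .trans (ih₁ e) (ih₂ e)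
  | app _ _ ih₁ ih₂ => exact .app (ih₁ e) (ih₂ e)
  | lam _ ih => exact .lam (ih _)
  | @beta Γ σ τ t u =>
    have key : (t.bind (e.lift σ)).bind (Env.inst (u.bind e)) = (t.bind (Env.inst u)).bind e := by
      rw [Raw.bind_bind, Raw.bind_bind]
      congr 1
      apply Env.ext
      · funext τ v
        cases v with
        | here => rfl
        | there v => exact Raw.inst_shift _ _
      · funext τ x
        exact Raw.inst_shift _ _
      · funext τ a
        exact Raw.inst_shift _ _
    have h := Conv.beta (t.bind (e.lift σ)) (u.bind e)
    rw [key] at h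
    exact h
  | @eta Γ σ τ t =>
    have h := Conv.eta (t.bind e)
    rw [← Raw.bind_shift] at h
    exact h

/-! ## Terms and formulas: lambda-terms modulo lambda-conversion -/

/-- Lambda-conversion as a setoid. -/
def convSetoid (L : Lang) (Γ : List L.Ty) (τ : L.Ty) : Setoid (Raw L Γ τ) where
  r := Conv
  iseqv := ⟨.refl, .symm, .trans⟩

/-- Terms of type `τ`. -/
def Term (L : Lang) (τ : L.Ty) : Type := Quotient (convSetoid L [] τ)

/-- Formulas: terms of type `o`. -/
abbrev Fm (L : Lang) : Type := Term L .o

/-- The term presented by a lambda-term. -/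
def Term.mk {L : Lang} {τ : L.Ty} (t : Raw L [] τ) : Term L τ := Quotient.mk (convSetoid L [] τ) t

/-- A variable as a term. -/
def Term.var {L : Lang} {τ : L.Ty} (x : EVar τ) : Term L τ := .mk (.fvar x)

/-- A nominal constant as a term. -/
def Term.nom {L : Lang} {τ : L.Ty} (a : L.Nom τ) : Term L τ := .mk (.nom a)

/-- A non-nominal constant as a term. -/
def Term.const {L : Lang} {τ : L.Ty} (c : Const L τ) : Term L τ := .mk (.const c)

/-- Application of terms. For `B = λx.B'` and `t`, `B.app t` is the term `B'[t/x]`. -/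
def Term.app {L : Lang} {σ τ : L.Ty} (t : Term L (.arr σ τ)) (u : Term L σ) : Term L τ :=
  Quotient.map₂ (sa := convSetoid L [] (.arr σ τ)) (sb := convSetoid L [] σ)
    (sc := convSetoid L [] τ) Raw.app (fun _ _ h _ _ h' => Conv.app h h') t u

/-- The free variables of a term: those that occur in all the lambda-terms that present it, that
is, those that occur in its normal form. -/
def Term.fvars {L : Lang} {τ : L.Ty} (t : Term L τ) : Set L.Var :=
  {x | ∀ r : Raw L [] τ, Term.mk r = t → x ∈ r.fvars}

/-- The support of a term: the nominal constants that occur in all the lambda-terms that present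
it, that is, those that occur in its normal form. -/
def Term.supp {L : Lang} {τ : L.Ty} (t : Term L τ) : Set L.Nominal :=
  {a | ∀ r : Raw L [] τ, Term.mk r = t → a ∈ r.noms}

/-- Heterogeneous lists. -/
inductive HL {β : Type} (F : SType β → Type) : List (SType β) → Type
  | nil : HL F []
  | cons {τ : SType β} {ts : List (SType β)} (a : F τ) (as : HL F ts) : HL F (τ :: ts)

/-- The entries of a heterogeneous list, together with their types. -/
def HL.toList {β : Type} {F : SType β → Type} : {ts : List (SType β)} → HL F ts → List (Σ τ, F τ)
  | _, .nil => []
  | _, .cons a as => ⟨_, a⟩ :: as.toList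

/-- Entrywise map. -/
def HL.map {β : Type} {F G : SType β → Type} (f : ∀ τ, F τ → G τ) :
    {ts : List (SType β)} → HL F ts → HL G ts
  | _, .nil => .nil
  | _, .cons a as => .cons (f _ a) (as.map f)

/-- `t.apps [t₁, …, tₙ]` is the curried application `t t₁ ⋯ tₙ`. -/
def Term.apps {L : Lang} {τ : L.Ty} :
    {ts : List L.Ty} → Term L (arrows ts τ) → HL (Term L) ts → Term L τ
  | _, t, .nil => t
  | _, t, .cons u us => Term.apps (t.app u) us

/-- A list of variables as a list of terms. -/
def varTerms {L : Lang} {ts : List L.Ty} (xs : HL (fun τ : L.Ty => EVar τ) ts) : HL (Term L) ts :=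
  xs.map fun _ x => Term.var x

/-- A list of nominal constants as a list of terms. -/
def nomTerms {L : Lang} {ts : List L.Ty} (cs : HL L.Nom ts) : HL (Term L) ts :=
  cs.map fun _ c => Term.nom c

/-- `⊤`. -/
def fTop {L : Lang} : Fm L := .const .top

/-- `⊥`. -/
def fBot {L : Lang} : Fm L := .const .bot

/-- `B ∧ C`. -/
def fAnd {L : Lang} (B C : Fm L) : Fm L := ((Term.const .and).app B).app C

/-- `B ∨ C`. -/
def fOr {L : Lang} (B C : Fm L) : Fm L := ((Term.const .or).app B).app C

/-- `B ⊃ C`. -/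
def fImp {L : Lang} (B C : Fm L) : Fm L := ((Term.const .imp).app B).app C

/-- `∀x.B`, where `B` is given as the abstraction `λx.B`; likewise for the next two. -/
def fAll {L : Lang} {τ : L.Ty} (h : τ.OFree) (B : Term L (.arr τ .o)) : Fm L :=
  (Term.const (.all h)).app B

/-- `∃x.B`. -/
def fEx {L : Lang} {τ : L.Ty} (h : τ.OFree) (B : Term L (.arr τ .o)) : Fm L :=
  (Term.const (.ex h)).app B

/-- `∇x.B`. -/
def fNab {L : Lang} {τ : L.Ty} (h : L.NabTy τ) (B : Term L (.arr τ .o)) : Fm L :=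
  (Term.const (.nab h)).app B

/-- The nominal abstraction `s ⊵ t`, as a formula. -/
def fNa {L : Lang} {ts : List L.Ty} {τ : L.Ty} (h : L.NaTy ts τ) (s : Term L (arrows ts τ))
    (t : Term L τ) : Fm L :=
  ((Term.const (.na h)).app s).app t

/-- The atomic formula `p t₁ ⋯ tₙ`. -/
def fAtom {L : Lang} {ts : List L.Ty} (p : L.Pr ts) (us : HL (Term L) ts) : Fm L :=
  (Term.const (.pr p)).apps us

/-! ## Permutations of nominal constants -/

/-- Type-preserving bijections on the nominal constants that move only finitely many of them. -/
structure NPerm (L : Lang) where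
  toEquiv : ∀ τ : L.Ty, Equiv.Perm (L.Nom τ)
  finite_moved : {a : L.Nominal | toEquiv a.1 a.2 ≠ a.2}.Finite

/-- The action of a permutation on nominal constants. -/
def NPerm.onNom {L : Lang} (π : NPerm L) (a : L.Nominal) : L.Nominal := ⟨a.1, π.toEquiv a.1 a.2⟩

/-- `π.t`: the application of a permutation to a term. -/
def NPerm.act {L : Lang} {τ : L.Ty} (π : NPerm L) (t : Term L τ) : Term L τ :=
  Quotient.map (sa := convSetoid L [] τ) (sb := convSetoid L [] τ)
    (Raw.bind ⟨fun _ v => .bvar v, fun _ x => .fvar x, fun τ a => .nom (π.toEquiv τ a)⟩)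
    (fun _ _ h => Conv.bind h _) t

/-- `B ≈ B'`: `B` is `π.B'` for a permutation `π`. -/
def PermEq {L : Lang} {τ : L.Ty} (B B' : Term L τ) : Prop := ∃ π : NPerm L, B = π.act B'

/-! ## Substitutions -/

/-- Substitutions: type-preserving maps from variables to terms that are the identity at all but
finitely many variables. -/
structure Subst (L : Lang) where
  toFun : ∀ τ : L.Ty, EVar τ → Term L τ
  finite_dom : {x : L.Var | toFun x.1 x.2 ≠ Term.var x.2}.Finite

/-- The domain of a substitution. -/
def Subst.dom {L : Lang} (θ : Subst L) : Set L.Var := {x | θ.toFun x.1 x.2 ≠ Term.var x.2}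

/-- The support of a substitution. -/
def Subst.supp {L : Lang} (θ : Subst L) : Set L.Nominal :=
  {a | ∃ x ∈ θ.dom, a ∈ (θ.toFun x.1 x.2).supp}

/-- `B[θ]`: the ordinary application of a substitution. (Any other choice of lambda-terms to
present the terms of the range gives the same term.) -/
def Subst.apply {L : Lang} {τ : L.Ty} (θ : Subst L) (B : Term L τ) : Term L τ :=
  Quotient.map (sa := convSetoid L [] τ) (sb := convSetoid L [] τ)
    (Raw.bind ⟨fun _ v => .bvar v, fun τ x => Quotient.out (θ.toFun τ x), fun _ a => .nom a⟩)
    (fun _ _ h => Conv.bind h _) B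

/-- `Σθ`: the application of a substitution to a signature. -/
def Subst.applySig {L : Lang} (θ : Subst L) (S : Set L.Var) : Set L.Var :=
  (S \ θ.dom) ∪ {y | ∃ x ∈ θ.dom, y ∈ (θ.toFun x.1 x.2).fvars}

/-- `θ.NCAS B B'`: the formula `B'` is a value of the nominal capture avoiding application
`B⟨θ⟩`, that is, `B' = (π.B)[θ]` for a permutation `π` that maps the nominal constants in the
support of `B` to ones that are not in the support of `θ`. -/
def Subst.NCAS {L : Lang} {τ : L.Ty} (θ : Subst L) (B B' : Term L τ) : Prop :=
  ∃ π : NPerm L, (∀ a ∈ B.supp, π.onNom a ∉ θ.supp) ∧ B' = θ.apply (π.act B)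

/-- The multiset `Γ'` is a value of `Γ⟨θ⟩`. -/
def Subst.NCASs {L : Lang} (θ : Subst L) (Γ Γ' : Multiset (Fm L)) : Prop :=
  Multiset.Rel θ.NCAS Γ Γ'

/-! ## Nominal abstraction -/

open Classical in
/-- `λc.t` for a nominal constant `c`: replace `c` by a new bound variable and abstract it. -/
def Raw.absNom {L : Lang} {σ τ : L.Ty} (c : L.Nom σ) (t : Raw L [] τ) : Raw L [] (.arr σ τ) :=
  .lam (t.bind
    { bv := fun _ v => .bvar (.there v)
      fv := fun _ x => .fvar x
      nm := fun τ a =>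
        Function.update (fun d : L.Nominal => (Raw.nom d.2 : Raw L [σ] d.1)) ⟨σ, c⟩
          (.bvar .here) ⟨τ, a⟩ })

/-- `λc₁ ⋯ λcₙ.t`. -/
def Raw.absNoms {L : Lang} {τ : L.Ty} (t : Raw L [] τ) :
    {ts : List L.Ty} → HL L.Nom ts → Raw L [] (arrows ts τ)
  | _, .nil => t
  | _, .cons c cs => Raw.absNom c (Raw.absNoms t cs)

/-- The nominal abstraction `s ⊵ t` holds: `s` is `λc₁ ⋯ λcₙ.t` for some distinct nominal
constants `c₁, …, cₙ`. -/
def NaHolds {L : Lang} {ts : List L.Ty} {τ : L.Ty} (s : Term L (arrows ts τ)) (t : Term L τ) :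
    Prop :=
  ∃ cs : HL L.Nom ts, cs.toList.Nodup ∧
    ∃ r : Raw L [] τ, Term.mk r = t ∧ s = Term.mk (r.absNoms cs)

/-- `θ` is a solution of `s ⊵ t`: `(s ⊵ t)⟨θ⟩` holds. One permutation is used for both sides. -/
def Subst.Solves {L : Lang} (θ : Subst L) {ts : List L.Ty} {τ : L.Ty} (s : Term L (arrows ts τ))
    (t : Term L τ) : Prop :=
  ∃ π : NPerm L, (∀ a ∈ s.supp ∪ t.supp, π.onNom a ∉ θ.supp) ∧
    NaHolds (θ.apply (π.act s)) (θ.apply (π.act t))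

/-! ## Definitions -/

/-- The three sorts of clauses. -/
inductive FixKind : Type
  | plain
  | mu
  | nu

/-- A clause `∀x⃗. p x⃗ ≜ B p x⃗` (or with `μ` or `ν`) for a predicate with argument types `ts`.
The body `B` has neither free variables nor nominal constants. -/
structure Clause (L : Lang) (ts : List L.Ty) where
  kind : FixKind
  body : Term L (.arr (arrows ts .o) (arrows ts .o))
  body_closed : body.fvars = ∅
  body_supp : body.supp = ∅

/-- A definition: at most one clause for each predicate constant. -/
def Definition (L : Lang) : Type := ∀ ts : List L.Ty, L.Pr ts → Option (Clause L ts)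

/-! ## Sequents, rules, derivations -/

/-- Sequents `Σ : Γ ⊢ C`. -/
structure Sequent (L : Lang) where
  sig : Set L.Var
  hyps : Multiset (Fm L)
  concl : Fm L

/-- The signature is finite and contains all the free variables of the formulas. -/
structure Sequent.WF {L : Lang} (q : Sequent L) : Prop where
  sig_finite : q.sig.Finite
  hyps_fvars : ∀ B ∈ q.hyps, B.fvars ⊆ q.sig
  concl_fvars : q.concl.fvars ⊆ q.sig

/-- `cs` is a listing, without repetitions, of the support of `B`. -/
def Lists {L : Lang} {τ : L.Ty} {cs : List L.Ty} (c : HL L.Nom cs) (B : Term L τ) : Prop :=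
  c.toList.Nodup ∧ ∀ a : L.Nominal, a ∈ c.toList ↔ a ∈ B.supp

/-- The inference rules of the logic: `Rule D prem q` says that `q` can be inferred by one rule
from the premises `prem i`. -/
inductive Rule {L : Lang} (D : Definition L) : {I : Type} → (I → Sequent L) → Sequent L → Prop
  | id (S : Set L.Var) (Γ : Multiset (Fm L)) (B B' : Fm L) (h : PermEq B B') :
      Rule D ![] ⟨S, B ::ₘ Γ, B'⟩
  | cut (S : Set L.Var) (Γ Δ : Multiset (Fm L)) (B C : Fm L) :
      Rule D ![⟨S, Γ, B⟩, ⟨S, B ::ₘ Δ, C⟩] ⟨S, Γ + Δ, C⟩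
  | contrL (S : Set L.Var) (Γ : Multiset (Fm L)) (B C : Fm L) :
      Rule D ![⟨S, B ::ₘ B ::ₘ Γ, C⟩] ⟨S, B ::ₘ Γ, C⟩
  | botL (S : Set L.Var) (Γ : Multiset (Fm L)) (C : Fm L) :
      Rule D ![] ⟨S, fBot ::ₘ Γ, C⟩
  | topR (S : Set L.Var) (Γ : Multiset (Fm L)) :
      Rule D ![] ⟨S, Γ, fTop⟩
  | orL (S : Set L.Var) (Γ : Multiset (Fm L)) (A B C : Fm L) :
      Rule D ![⟨S, A ::ₘ Γ, C⟩, ⟨S, B ::ₘ Γ, C⟩] ⟨S, fOr A B ::ₘ Γ, C⟩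
  | orR₁ (S : Set L.Var) (Γ : Multiset (Fm L)) (A B : Fm L) :
      Rule D ![⟨S, Γ, A⟩] ⟨S, Γ, fOr A B⟩
  | orR₂ (S : Set L.Var) (Γ : Multiset (Fm L)) (A B : Fm L) :
      Rule D ![⟨S, Γ, B⟩] ⟨S, Γ, fOr A B⟩
  | andL₁ (S : Set L.Var) (Γ : Multiset (Fm L)) (A B C : Fm L) :
      Rule D ![⟨S, A ::ₘ Γ, C⟩] ⟨S, fAnd A B ::ₘ Γ, C⟩
  | andL₂ (S : Set L.Var) (Γ : Multiset (Fm L)) (A B C : Fm L) :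
      Rule D ![⟨S, B ::ₘ Γ, C⟩] ⟨S, fAnd A B ::ₘ Γ, C⟩
  | andR (S : Set L.Var) (Γ : Multiset (Fm L)) (A B : Fm L) :
      Rule D ![⟨S, Γ, A⟩, ⟨S, Γ, B⟩] ⟨S, Γ, fAnd A B⟩
  | impL (S : Set L.Var) (Γ : Multiset (Fm L)) (A B C : Fm L) :
      Rule D ![⟨S, Γ, A⟩, ⟨S, B ::ₘ Γ, C⟩] ⟨S, fImp A B ::ₘ Γ, C⟩
  | impR (S : Set L.Var) (Γ : Multiset (Fm L)) (A B : Fm L) :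
      Rule D ![⟨S, A ::ₘ Γ, B⟩] ⟨S, Γ, fImp A B⟩
  | allL (S : Set L.Var) (Γ : Multiset (Fm L)) {τ : L.Ty} (hτ : τ.OFree) (B : Term L (.arr τ .o))
      (C : Fm L) (t : Term L τ) (ht : t.fvars ⊆ S) :
      Rule D ![⟨S, B.app t ::ₘ Γ, C⟩] ⟨S, fAll hτ B ::ₘ Γ, C⟩
  | allR (S : Set L.Var) (Γ : Multiset (Fm L)) {τ : L.Ty} (hτ : τ.OFree) (B : Term L (.arr τ .o))
      {cs : List L.Ty} (c : HL L.Nom cs) (hc : Lists c B) (h : EVar (arrows cs τ))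
      (hh : (⟨_, h⟩ : L.Var) ∉ S) :
      Rule D ![⟨insert ⟨_, h⟩ S, Γ, B.app ((Term.var h).apps (nomTerms c))⟩] ⟨S, Γ, fAll hτ B⟩
  | nabL (S : Set L.Var) (Γ : Multiset (Fm L)) {τ : L.Ty} (hτ : L.NabTy τ)
      (B : Term L (.arr τ .o)) (C : Fm L) (a : L.Nom τ) (ha : (⟨τ, a⟩ : L.Nominal) ∉ B.supp) :
      Rule D ![⟨S, B.app (.nom a) ::ₘ Γ, C⟩] ⟨S, fNab hτ B ::ₘ Γ, C⟩
  | nabR (S : Set L.Var) (Γ : Multiset (Fm L)) {τ : L.Ty} (hτ : L.NabTy τ)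
      (B : Term L (.arr τ .o)) (a : L.Nom τ) (ha : (⟨τ, a⟩ : L.Nominal) ∉ B.supp) :
      Rule D ![⟨S, Γ, B.app (.nom a)⟩] ⟨S, Γ, fNab hτ B⟩
  | exL (S : Set L.Var) (Γ : Multiset (Fm L)) {τ : L.Ty} (hτ : τ.OFree) (B : Term L (.arr τ .o))
      (C : Fm L) {cs : List L.Ty} (c : HL L.Nom cs) (hc : Lists c B) (h : EVar (arrows cs τ))
      (hh : (⟨_, h⟩ : L.Var) ∉ S) :
      Rule D ![⟨insert ⟨_, h⟩ S, B.app ((Term.var h).apps (nomTerms c)) ::ₘ Γ, C⟩]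
        ⟨S, fEx hτ B ::ₘ Γ, C⟩
  | exR (S : Set L.Var) (Γ : Multiset (Fm L)) {τ : L.Ty} (hτ : τ.OFree) (B : Term L (.arr τ .o))
      (t : Term L τ) (ht : t.fvars ⊆ S) :
      Rule D ![⟨S, Γ, B.app t⟩] ⟨S, Γ, fEx hτ B⟩
  /-- One premise `Σθ : Γ⟨θ⟩ ⊢ C⟨θ⟩` for each solution `θ`; `G θ` and `E θ` are the values chosen
  for `Γ⟨θ⟩` and `C⟨θ⟩`. -/
  | naL (S : Set L.Var) (Γ : Multiset (Fm L)) {ts : List L.Ty} {τ : L.Ty} (hn : L.NaTy ts τ)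
      (s : Term L (arrows ts τ)) (t : Term L τ) (C : Fm L)
      (G : {θ : Subst L // θ.Solves s t} → Multiset (Fm L))
      (E : {θ : Subst L // θ.Solves s t} → Fm L)
      (hG : ∀ θ : {θ : Subst L // θ.Solves s t}, θ.1.NCASs Γ (G θ))
      (hE : ∀ θ : {θ : Subst L // θ.Solves s t}, θ.1.NCAS C (E θ)) :
      Rule D (fun θ : {θ : Subst L // θ.Solves s t} => ⟨θ.1.applySig S, G θ, E θ⟩) ⟨S, fNa hn s t ::ₘ Γ, C⟩
  | naR (S : Set L.Var) (Γ : Multiset (Fm L)) {ts : List L.Ty} {τ : L.Ty} (hn : L.NaTy ts τ)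
      (s : Term L (arrows ts τ)) (t : Term L τ) (h : NaHolds s t) :
      Rule D ![] ⟨S, Γ, fNa hn s t⟩
  | defL (S : Set L.Var) (Γ : Multiset (Fm L)) {ts : List L.Ty} (p : L.Pr ts) (cl : Clause L ts)
      (hcl : D ts p = some cl) (us : HL (Term L) ts) (C : Fm L) :
      Rule D ![⟨S, (cl.body.app (.const (.pr p))).apps us ::ₘ Γ, C⟩] ⟨S, fAtom p us ::ₘ Γ, C⟩
  | defR (S : Set L.Var) (Γ : Multiset (Fm L)) {ts : List L.Ty} (p : L.Pr ts) (cl : Clause L ts)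
      (hcl : D ts p = some cl) (us : HL (Term L) ts) :
      Rule D ![⟨S, Γ, (cl.body.app (.const (.pr p))).apps us⟩] ⟨S, Γ, fAtom p us⟩
  /-- Induction, with invariant `V` and distinct variables `xs`. -/
  | indL (S : Set L.Var) (Γ : Multiset (Fm L)) {ts : List L.Ty} (p : L.Pr ts) (cl : Clause L ts)
      (hcl : D ts p = some cl) (hmu : cl.kind = .mu) (us : HL (Term L) ts) (C : Fm L)
      (V : Term L (arrows ts .o)) (hVc : V.fvars = ∅) (hVn : V.supp = ∅)
      (xs : HL (fun τ : L.Ty => EVar τ) ts) (hxs : xs.toList.Nodup) :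
      Rule D ![⟨{x | x ∈ xs.toList}, {(cl.body.app V).apps (varTerms xs)}, V.apps (varTerms xs)⟩,
        ⟨S, V.apps us ::ₘ Γ, C⟩] ⟨S, fAtom p us ::ₘ Γ, C⟩
  /-- Co-induction, with co-invariant `V` and distinct variables `xs`. -/
  | coindR (S : Set L.Var) (Γ : Multiset (Fm L)) {ts : List L.Ty} (p : L.Pr ts) (cl : Clause L ts)
      (hcl : D ts p = some cl) (hnu : cl.kind = .nu) (us : HL (Term L) ts)
      (V : Term L (arrows ts .o)) (hVc : V.fvars = ∅) (hVn : V.supp = ∅)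
      (xs : HL (fun τ : L.Ty => EVar τ) ts) (hxs : xs.toList.Nodup) :
      Rule D ![⟨S, Γ, V.apps us⟩,
        ⟨{x | x ∈ xs.toList}, {V.apps (varTerms xs)}, (cl.body.app V).apps (varTerms xs)⟩]
        ⟨S, Γ, fAtom p us⟩

/-- Derivations (proofs): well-founded trees of well-formed sequents, built by the rules. -/
inductive Deriv {L : Lang} (D : Definition L) : Sequent L → Type 1
  | node {q : Sequent L} {I : Type} (prem : I → Sequent L) (wf : q.WF) (r : Rule D prem q)
      (sub : ∀ i, Deriv D (prem i)) : Deriv D q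

open Classical in
/-- The height of a derivation: `1` if there are no premises, otherwise the least upper bound of
the ordinals `ht Πᵢ + 1` for the premise derivations `Πᵢ`. -/
def Deriv.ht {L : Lang} {D : Definition L} : {q : Sequent L} → Deriv D q → Ordinal.{0}
  | _, .node (I := I) _ _ _ sub => if IsEmpty I then 1 else ⨆ i : I, ((sub i).ht + 1)

end

end NomAbs

open NomAbs

namespace NomAbs

/-! ## Confluence of beta-eta reduction -/

/-! The proof is an induction on derivations that turns each inference into an inference by the same
rule; only the names need care. The statement proved by induction, `Deriv.exists_val`, is more
general than the lemma. There θ is any map on variables, F is a finite set of nominal constants and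
S' a finite signature such that, on Σ, the terms θ(x) have support in F and free variables in S'. A
value of B is (π.B)[θ] where π carries supp(B) outside F, and π may differ from formula to formula.
The lemma is the case F = supp(θ), S' = Σθ. The identity with F = ∅ is equally useful: it replaces
formulas by ≈-variants and enlarges the signature without raising the height.

Two facts about permutations drive the cases. Any two values of a formula agree up to ≈
(`IsVal.permEq`), which settles the axiom rule. A permutation matters only on supp(B), so it can be
altered elsewhere to keep further constants away from F (`NPerm.exists_fresh`); this gives instances
of quantified formulas. An eigenvariable h raised over c⃗ is sent to λ(π.c⃗). h' c⃗', whose support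
still lies in F (`exists_raise`). For ⊵L, a solution ρ of the instance yields a solution ρ' of the
original, namely ρ after θ with the constants of θ renamed away from ρ, and instantiating by ρ' or
by θ and then ρ gives the same formula up to ≈ (`Subst.Solves.exists_of_val`). The premise for ρ is
thus obtained from the premise for ρ' by the induction hypothesis for the identity. Every new
premise comes from an old one, so heights do not grow.

Underneath lies a syntactic fact. Free variables and support are intersections over all
presentations of a term. The Church-Rosser property (`Conv.join`) provides a presentation attaining
both (`Term.exists_exact`) and shows that the support of a compound formula is exactly the union of
the supports of its parts, so that a permutation admissible for a formula is admissible for its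
components. No normalization is needed: a presentation with the fewest names does the work of the
normal form. -/

/-- Parallel beta-eta reduction. -/
inductive Par {L : Lang} : {Γ : List L.Ty} → {τ : L.Ty} → Raw L Γ τ → Raw L Γ τ → Prop
  | bvar {Γ : List L.Ty} {τ : L.Ty} (v : Mem Γ τ) : Par (.bvar v) (.bvar v)
  | fvar {Γ : List L.Ty} {τ : L.Ty} (x : EVar τ) : Par (Γ := Γ) (.fvar x) (.fvar x)
  | nom {Γ : List L.Ty} {τ : L.Ty} (a : L.Nom τ) : Par (Γ := Γ) (.nom a) (.nom a)
  | const {Γ : List L.Ty} {τ : L.Ty} (c : Const L τ) : Par (Γ := Γ) (.const c) (.const c)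
  | app {Γ : List L.Ty} {σ τ : L.Ty} {t t' : Raw L Γ (.arr σ τ)} {u u' : Raw L Γ σ} :
      Par t t' → Par u u' → Par (.app t u) (.app t' u')
  | lam {Γ : List L.Ty} {σ τ : L.Ty} {t t' : Raw L (σ :: Γ) τ} :
      Par t t' → Par (.lam t) (.lam t')
  | beta {Γ : List L.Ty} {σ τ : L.Ty} {t t' : Raw L (σ :: Γ) τ} {u u' : Raw L Γ σ} :
      Par t t' → Par u u' → Par (.app (.lam t) u) (t'.bind (Env.inst u'))
  | eta {Γ : List L.Ty} {σ τ : L.Ty} {t t' : Raw L Γ (.arr σ τ)} :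
      Par t t' → Par (.lam (.app (t.ren (Ren.shift σ)) (.bvar .here))) t'

theorem Par.refl {L : Lang} {Γ : List L.Ty} {τ : L.Ty} (t : Raw L Γ τ) : Par t t := by
  induction t with
  | bvar v => exact .bvar v
  | fvar x => exact .fvar x
  | nom a => exact .nom a
  | const c => exact .const c
  | app _ _ h₁ h₂ => exact .app h₁ h₂
  | lam _ h => exact .lam h

theorem Par.conv {L : Lang} {Γ : List L.Ty} {τ : L.Ty} {t u : Raw L Γ τ} (h : Par t u) :
    Conv t u := by
  induction h with
  | app _ _ h₁ h₂ => exact .app h₁ h₂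
  | lam _ h => exact .lam h
  | beta _ _ h₁ h₂ => exact .trans (.app (.lam h₁) h₂) (.beta _ _)
  | eta _ h => exact .trans (.eta _) h
  | _ => exact .refl _

/-! ### Commutation of renaming, instantiation and replacement -/

theorem Raw.ren_eq_bind {L : Lang} {Γ Δ : List L.Ty} {τ : L.Ty} (t : Raw L Γ τ) (r : Ren Γ Δ) :
    t.ren r = t.bind ⟨fun τ v => .bvar (r τ v), fun _ x => .fvar x, fun _ a => .nom a⟩ := by
  rw [← Raw.bind_id (t.ren r), Raw.bind_ren]

theorem Raw.ren_shift_lift {L : Lang} {Γ Δ : List L.Ty} {σ τ : L.Ty} (t : Raw L Γ τ)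
    (r : Ren Γ Δ) :
    (t.ren (Ren.shift σ)).ren (r.lift σ) = (t.ren r).ren (Ren.shift σ) := by
  rw [Raw.ren_ren, Raw.ren_ren]
  rfl

theorem Raw.inst_ren {L : Lang} {Γ Δ : List L.Ty} {σ τ : L.Ty} (t : Raw L (σ :: Γ) τ)
    (u : Raw L Γ σ) (r : Ren Γ Δ) :
    (t.bind (Env.inst u)).ren r = (t.ren (r.lift σ)).bind (Env.inst (u.ren r)) := by
  rw [Raw.ren_bind, Raw.bind_ren]
  congr 1
  apply Env.ext
  · funext τ v
    cases v <;> rfl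
  · rfl
  · rfl

theorem Raw.inst_bind {L : Lang} {Γ Δ : List L.Ty} {σ τ : L.Ty} (t : Raw L (σ :: Γ) τ)
    (u : Raw L Γ σ) (e : Env L Γ Δ) :
    (t.bind (Env.inst u)).bind e = (t.bind (e.lift σ)).bind (Env.inst (u.bind e)) := by
  rw [Raw.bind_bind, Raw.bind_bind]
  congr 1
  apply Env.ext
  · funext τ v
    cases v with
    | here => rfl
    | there v => exact (Raw.inst_shift _ _).symm
  · funext τ x
    exact (Raw.inst_shift _ _).symm
  · funext τ a
    exact (Raw.inst_shift _ _).symm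

/-! ### Parallel reduction under renaming and replacement -/

theorem Par.ren {L : Lang} {Γ Δ : List L.Ty} {τ : L.Ty} {t u : Raw L Γ τ} (h : Par t u)
    (r : Ren Γ Δ) : Par (t.ren r) (u.ren r) := by
  induction h generalizing Δ with
  | bvar v => exact .bvar _
  | fvar x => exact .fvar _
  | nom a => exact .nom _
  | const c => exact .const _
  | app _ _ h₁ h₂ => exact .app (h₁ r) (h₂ r)
  | lam _ h => exact .lam (h _)
  | beta _ _ h₁ h₂ =>
    rw [Raw.inst_ren]
    exact .beta (h₁ _) (h₂ _)
  | eta _ h =>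
    have := Par.eta (h r)
    rw [← Raw.ren_shift_lift] at this
    exact this

theorem Par.bind {L : Lang} {Γ Δ : List L.Ty} {τ : L.Ty} {t u : Raw L Γ τ} (h : Par t u)
    {e f : Env L Γ Δ} (hb : ∀ τ v, Par (e.bv τ v) (f.bv τ v))
    (hf : ∀ τ x, Par (e.fv τ x) (f.fv τ x)) (hn : ∀ τ a, Par (e.nm τ a) (f.nm τ a)) :
    Par (t.bind e) (u.bind f) := by
  have lift : ∀ {Γ Δ : List L.Ty} {e f : Env L Γ Δ} (σ : L.Ty),
      (∀ τ v, Par (e.bv τ v) (f.bv τ v)) → ∀ τ v, Par ((e.lift σ).bv τ v) ((f.lift σ).bv τ v) := by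
    intro Γ Δ e f σ hb τ v
    cases v with
    | here => exact .bvar _
    | there v => exact (hb _ v).ren _
  induction h generalizing Δ with
  | bvar v => exact hb _ v
  | fvar x => exact hf _ x
  | nom a => exact hn _ a
  | const c => exact .const _
  | app _ _ h₁ h₂ => exact .app (h₁ hb hf hn) (h₂ hb hf hn)
  | lam _ h => exact .lam (h (lift _ hb) (fun τ x => (hf τ x).ren _) fun τ a => (hn τ a).ren _)
  | beta _ _ h₁ h₂ =>
    rw [Raw.inst_bind]
    exact .beta (h₁ (lift _ hb) (fun τ x => (hf τ x).ren _) fun τ a => (hn τ a).ren _)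
      (h₂ hb hf hn)
  | eta _ h =>
    have := Par.eta (h hb hf hn)
    rw [← Raw.bind_shift] at this
    exact this

theorem Par.inst {L : Lang} {Γ : List L.Ty} {σ τ : L.Ty} {t t' : Raw L (σ :: Γ) τ}
    {u u' : Raw L Γ σ} (h : Par t t') (hu : Par u u') :
    Par (t.bind (Env.inst u)) (t'.bind (Env.inst u')) := by
  refine h.bind (fun τ v => ?_) (fun _ _ => .refl _) fun _ _ => .refl _
  cases v with
  | here => exact hu
  | there v => exact .refl _

/-- The hypothesis says that p and q cover the pullback of r and s on indices; binders preserve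
this, so it passes to terms. It serves to strengthen terms: a term in the image of two renamings
comes from their common source. -/
theorem Raw.ren_pullback {L : Lang} {Γ : List L.Ty} {τ : L.Ty} (t : Raw L Γ τ) :
    ∀ {Δ Θ Ξ : List L.Ty} (r : Ren Γ Θ) (s : Ren Δ Θ) (p : Ren Ξ Γ) (q : Ren Ξ Δ),
      (∀ τ v w, r τ v = s τ w → ∃ z, p τ z = v ∧ q τ z = w) →
      ∀ u : Raw L Δ τ, t.ren r = u.ren s → ∃ z : Raw L Ξ τ, z.ren p = t ∧ z.ren q = u := by
  induction t with
  | bvar v =>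
    intro Δ Θ Ξ r s p q H u h
    cases u <;> simp only [Raw.ren, reduceCtorEq, Raw.bvar.injEq] at h
    obtain ⟨z, rfl, rfl⟩ := H _ _ _ h
    exact ⟨.bvar z, rfl, rfl⟩
  | fvar x =>
    intro Δ Θ Ξ r s p q H u h
    cases u <;> simp only [Raw.ren, reduceCtorEq, Raw.fvar.injEq] at h
    subst h
    exact ⟨.fvar x, rfl, rfl⟩
  | nom x =>
    intro Δ Θ Ξ r s p q H u h
    cases u <;> simp only [Raw.ren, reduceCtorEq, Raw.nom.injEq] at h
    subst h
    exact ⟨.nom x, rfl, rfl⟩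
  | const x =>
    intro Δ Θ Ξ r s p q H u h
    cases u <;> simp only [Raw.ren, reduceCtorEq, Raw.const.injEq] at h
    subst h
    exact ⟨.const x, rfl, rfl⟩
  | app t₁ t₂ ih₁ ih₂ =>
    intro Δ Θ Ξ r s p q H u h
    cases u <;> simp only [Raw.ren, reduceCtorEq, Raw.app.injEq] at h
    obtain ⟨rfl, h₁, h₂⟩ := h
    obtain ⟨z₁, rfl, rfl⟩ := ih₁ r s p q H _ (eq_of_heq h₁)
    obtain ⟨z₂, rfl, rfl⟩ := ih₂ r s p q H _ (eq_of_heq h₂)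
    exact ⟨.app z₁ z₂, rfl, rfl⟩
  | lam t ih =>
    intro Δ Θ Ξ r s p q H u h
    cases u <;> simp only [Raw.ren, reduceCtorEq, Raw.lam.injEq] at h
    obtain ⟨z, rfl, rfl⟩ := ih (r.lift _) (s.lift _) (p.lift _) (q.lift _) (by
      intro τ v w hvw
      cases v with
      | here =>
        cases w with
        | here => exact ⟨.here, rfl, rfl⟩
        | there w => simp [Ren.lift] at hvw
      | there v =>
        cases w with
        | here => simp [Ren.lift] at hvw
        | there w =>
          simp only [Ren.lift, Mem.there.injEq] at hvw
          obtain ⟨z, rfl, rfl⟩ := H _ _ _ hvw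
          exact ⟨.there z, rfl, rfl⟩) _ h
    exact ⟨.lam z, rfl, rfl⟩

theorem Raw.ren_shift_injective {L : Lang} {Γ : List L.Ty} {σ τ : L.Ty} {t u : Raw L Γ τ}
    (h : t.ren (Ren.shift σ) = u.ren (Ren.shift σ)) : t = u := by
  obtain ⟨z, rfl, rfl⟩ := Raw.ren_pullback t _ _ (fun _ v => v) (fun _ v => v) (by
    intro τ v w hvw
    simp only [Ren.shift, Mem.there.injEq] at hvw
    exact ⟨v, rfl, hvw⟩) u h
  rfl

/-- Renaming creates no redexes. Only eta is delicate: the function part of the redex is both a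
shift and the image of a lifted renaming, and `Raw.ren_pullback` shows that it was already a shift
before the renaming. -/
theorem Par.of_ren {L : Lang} {Γ Δ : List L.Ty} {τ : L.Ty} {x w : Raw L Δ τ} (h : Par x w)
    (t : Raw L Γ τ) (r : Ren Γ Δ) (hx : x = t.ren r) : ∃ t', w = t'.ren r ∧ Par t t' := by
  induction h generalizing Γ with
  | bvar v => exact ⟨t, hx, .refl t⟩
  | fvar v => exact ⟨t, hx, .refl t⟩
  | nom v => exact ⟨t, hx, .refl t⟩
  | const v => exact ⟨t, hx, .refl t⟩
  | app _ _ ih₁ ih₂ =>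
    cases t <;> simp only [Raw.ren, reduceCtorEq, Raw.app.injEq] at hx
    obtain ⟨rfl, h₁, h₂⟩ := hx
    obtain ⟨z₁, rfl, p₁⟩ := ih₁ _ r (eq_of_heq h₁)
    obtain ⟨z₂, rfl, p₂⟩ := ih₂ _ r (eq_of_heq h₂)
    exact ⟨.app z₁ z₂, rfl, .app p₁ p₂⟩
  | lam _ ih =>
    cases t <;> simp only [Raw.ren, reduceCtorEq, Raw.lam.injEq] at hx
    obtain ⟨z, rfl, p⟩ := ih _ _ hx
    exact ⟨.lam z, rfl, .lam p⟩
  | beta _ _ ih₁ ih₂ =>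
    cases t with
    | app t₁ t₂ =>
      simp only [Raw.ren, Raw.app.injEq] at hx
      obtain ⟨rfl, h₁, h₂⟩ := hx
      have h₁ := eq_of_heq h₁
      cases t₁ <;> simp only [Raw.ren, reduceCtorEq, Raw.lam.injEq] at h₁
      obtain ⟨z₁, rfl, p₁⟩ := ih₁ _ _ h₁
      obtain ⟨z₂, rfl, p₂⟩ := ih₂ _ _ (eq_of_heq h₂)
      exact ⟨_, (Raw.inst_ren _ _ _).symm, .beta p₁ p₂⟩
    | _ => simp [Raw.ren] at hx
  | @eta Γ' σ τ q q' _ ih =>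
    cases t with
    | lam t =>
      simp only [Raw.ren, Raw.lam.injEq] at hx
      cases t with
      | app t₁ t₂ =>
        simp only [Raw.ren, Raw.app.injEq] at hx
        obtain ⟨rfl, h₁, h₂⟩ := hx
        have h₁ := eq_of_heq h₁
        have h₂ := eq_of_heq h₂
        cases t₂ with
        | bvar v =>
          cases v with
          | here =>
            obtain ⟨z, rfl, rfl⟩ := Raw.ren_pullback t₁ (r.lift _) (Ren.shift _) (Ren.shift _) r (by
              intro τ v w hvw
              cases v with
              | here => simp [Ren.lift, Ren.shift] at hvw
              | there v =>
                simp only [Ren.lift, Ren.shift, Mem.there.injEq] at hvw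
                exact ⟨v, rfl, hvw⟩) q h₁.symm
            obtain ⟨z', rfl, p⟩ := ih z r rfl
            exact ⟨z', rfl, .eta p⟩
          | there v => simp [Raw.ren, Ren.lift] at h₂
        | _ => simp [Raw.ren] at h₂
      | _ => simp [Raw.ren] at hx
    | _ => simp [Raw.ren] at hx

/-- The number of constructors of a lambda-term. -/
def Raw.size {L : Lang} : {Γ : List L.Ty} → {τ : L.Ty} → Raw L Γ τ → ℕ
  | _, _, .app t u => t.size + u.size + 1
  | _, _, .lam t => t.size + 1
  | _, _, _ => 0

theorem Raw.size_ren {L : Lang} {Γ Δ : List L.Ty} {τ : L.Ty} (t : Raw L Γ τ) (r : Ren Γ Δ) :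
    (t.ren r).size = t.size := by
  induction t generalizing Δ with
  | app t u h₁ h₂ => simp [Raw.ren, Raw.size, h₁, h₂]
  | lam t h => simp [Raw.ren, Raw.size, h]
  | _ => rfl

theorem Raw.lift_shift_inst_here {L : Lang} {Γ : List L.Ty} {σ τ : L.Ty} (t : Raw L (σ :: Γ) τ) :
    (t.ren ((Ren.shift σ).lift σ)).bind (Env.inst (.bvar .here)) = t := by
  rw [Raw.bind_ren]
  conv_rhs => rw [← Raw.bind_id t]
  congr 1
  apply Env.ext
  · funext τ v
    cases v <;> rfl
  · rfl
  · rfl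

/-- Reducts of an eta-redex by a reduction of its body. -/
theorem Par.eta_body {L : Lang} {Γ : List L.Ty} {σ τ : L.Ty} {q : Raw L Γ (.arr σ τ)}
    {s : Raw L (σ :: Γ) τ} (h : Par (.app (q.ren (Ren.shift σ)) (.bvar .here)) s) :
    (∃ q', s = .app (q'.ren (Ren.shift σ)) (.bvar .here) ∧ Par q q') ∨ Par q (.lam s) := by
  generalize hx : q.ren (Ren.shift σ) = x at h
  cases h with
  | app h₁ h₂ =>
    cases h₂
    obtain ⟨q', rfl, p⟩ := h₁.of_ren q _ hx.symm
    exact .inl ⟨q', rfl, p⟩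
  | beta h₁ h₂ =>
    cases h₂
    cases q <;> simp only [Raw.ren, reduceCtorEq, Raw.lam.injEq] at hx
    obtain ⟨z, rfl, p⟩ := h₁.of_ren _ _ hx.symm
    -- Here q is itself an abstraction, and contracting its shifted copy applied to the new index
    -- gives back its body, reduced.
    rw [Raw.lift_shift_inst_here]
    exact .inr (.lam p)

/-- The induction is on size rather than on the reductions, because overlapping beta and eta redexes
call for the hypothesis at subterms that are reduced in other ways than the given ones. Size is
invariant under renaming, so the shifted function part of an eta-redex counts as the unshifted one.
-/
theorem Par.diamond_aux {L : Lang} (n : ℕ) : ∀ {Γ : List L.Ty} {τ : L.Ty} (t u v : Raw L Γ τ),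
    t.size < n → Par t u → Par t v → ∃ w, Par u w ∧ Par v w := by
  induction n with
  | zero => intro Γ τ t u v h; omega
  | succ n ih =>
    -- Eta contraction against reduction of the body. Either the eta-redex survives, or q itself
    -- reduces to the new abstraction.
    have lamEta : ∀ {Γ : List L.Ty} {σ τ : L.Ty} (q q' : Raw L Γ (.arr σ τ))
        (s : Raw L (σ :: Γ) τ), q.size < n →
        Par (.app (q.ren (Ren.shift σ)) (.bvar .here)) s → Par q q' →
        ∃ w, Par (.lam s) w ∧ Par q' w := by
      intro Γ σ τ q q' s hq hs hq'
      rcases hs.eta_body with ⟨q₁, rfl, h⟩ | h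
      · obtain ⟨w, h₁, h₂⟩ := ih _ _ _ hq h hq'
        exact ⟨w, .eta h₁, h₂⟩
      · exact ih _ _ _ hq h hq'
    -- Beta contraction against separate reduction of abstraction and argument. If the abstraction
    -- was contracted by eta, its body also reduces to a shifted term applied to the newest index,
    -- and instantiating that index yields the application.
    have betaApp : ∀ {Γ : List L.Ty} {σ τ : L.Ty} (t t' : Raw L (σ :: Γ) τ) (w : Raw L Γ _)
        (u u₁ u₂ : Raw L Γ σ), t.size < n → u.size < n → Par t t' → Par (.lam t) w → Par u u₁ →
        Par u u₂ → ∃ z, Par (t'.bind (Env.inst u₁)) z ∧ Par (.app w u₂) z := by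
      intro Γ σ τ t t' w u u₁ u₂ ht hu h hw hu₁ hu₂
      obtain ⟨v, hv₁, hv₂⟩ := ih _ _ _ hu hu₁ hu₂
      cases hw with
      | lam hs =>
        obtain ⟨z, hz₁, hz₂⟩ := ih _ _ _ ht h hs
        exact ⟨_, hz₁.inst hv₁, .beta hz₂ hv₂⟩
      | eta hq =>
        obtain ⟨z, hz₁, hz₂⟩ := ih _ _ _ ht h (.app (hq.ren _) (.refl _))
        refine ⟨_, hz₁.inst hv₁, ?_⟩
        have := hz₂.inst hv₂
        simp only [Raw.bind, Raw.inst_shift] at this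
        exact this
    intro Γ τ t u v hn hu hv
    cases hu with
    | bvar x => cases hv; exact ⟨_, .refl _, .refl _⟩
    | fvar x => cases hv; exact ⟨_, .refl _, .refl _⟩
    | nom x => cases hv; exact ⟨_, .refl _, .refl _⟩
    | const x => cases hv; exact ⟨_, .refl _, .refl _⟩
    | app h₁ h₂ =>
      simp only [Raw.size] at hn
      cases hv with
      | app h₃ h₄ =>
        obtain ⟨w, a, b⟩ := ih _ _ _ (by omega) h₁ h₃
        obtain ⟨w', a', b'⟩ := ih _ _ _ (by omega) h₂ h₄
        exact ⟨_, .app a a', .app b b'⟩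
      | beta h₃ h₄ =>
        simp only [Raw.size] at hn
        obtain ⟨z, a, b⟩ := betaApp _ _ _ _ _ _ (by omega) (by omega) h₃ h₁ h₄ h₂
        exact ⟨z, b, a⟩
    | beta h₁ h₂ =>
      simp only [Raw.size] at hn
      cases hv with
      | app h₃ h₄ => exact betaApp _ _ _ _ _ _ (by omega) (by omega) h₁ h₃ h₂ h₄
      | beta h₃ h₄ =>
        obtain ⟨w, a, b⟩ := ih _ _ _ (by omega) h₁ h₃
        obtain ⟨w', a', b'⟩ := ih _ _ _ (by omega) h₂ h₄
        exact ⟨_, a.inst a', b.inst b'⟩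
    | lam h₁ =>
      simp only [Raw.size] at hn
      cases hv with
      | lam h₂ =>
        obtain ⟨w, a, b⟩ := ih _ _ _ (by omega) h₁ h₂
        exact ⟨_, .lam a, .lam b⟩
      | eta h₂ =>
        simp only [Raw.size, Raw.size_ren] at hn
        exact lamEta _ _ _ (by omega) h₁ h₂
    | @eta _ _ _ q _ h₁ =>
      simp only [Raw.size, Raw.size_ren] at hn
      generalize hx : Raw.app (q.ren (Ren.shift _)) (.bvar .here) = x at hv
      cases hv with
      | lam h₂ =>
        subst hx
        obtain ⟨w, a, b⟩ := lamEta _ _ _ (by omega) h₂ h₁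
        exact ⟨w, b, a⟩
      | eta h₂ =>
        simp only [Raw.app.injEq, heq_eq_eq, true_and, and_true] at hx
        -- Both reductions contract the same eta-redex, and the shift determines its function part.
        cases Raw.ren_shift_injective hx
        exact ih _ _ _ (by omega) h₁ h₂

theorem Par.diamond {L : Lang} {Γ : List L.Ty} {τ : L.Ty} {t u v : Raw L Γ τ} (hu : Par t u)
    (hv : Par t v) : ∃ w, Par u w ∧ Par v w :=
  Par.diamond_aux _ t u v (Nat.lt_succ_self _) hu hv

/-- Beta-eta reduction. -/
def Red {L : Lang} {Γ : List L.Ty} {τ : L.Ty} : Raw L Γ τ → Raw L Γ τ → Prop :=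
  Relation.ReflTransGen Par

theorem Red.conv {L : Lang} {Γ : List L.Ty} {τ : L.Ty} {t u : Raw L Γ τ} (h : Red t u) :
    Conv t u := by
  induction h with
  | refl => exact .refl _
  | tail _ h ih => exact .trans ih h.conv

theorem Red.app {L : Lang} {Γ : List L.Ty} {σ τ : L.Ty} {t t' : Raw L Γ (.arr σ τ)}
    {u u' : Raw L Γ σ} (h : Red t t') (h' : Red u u') : Red (.app t u) (.app t' u') :=
  Relation.ReflTransGen.trans
    (h.lift (fun t => Raw.app t u) fun _ _ p => Par.app p (.refl _))
    (h'.lift (Raw.app t') fun _ _ p => Par.app (.refl _) p)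

theorem Red.lam {L : Lang} {Γ : List L.Ty} {σ τ : L.Ty} {t t' : Raw L (σ :: Γ) τ} (h : Red t t') :
    Red (.lam t) (.lam t') :=
  h.lift Raw.lam fun _ _ p => Par.lam p

/-- By the diamond property, having a common reduct is an equivalence relation. It is compatible
with application and abstraction and contains beta and eta, hence it contains conversion. -/
theorem Conv.join {L : Lang} {Γ : List L.Ty} {τ : L.Ty} {t u : Raw L Γ τ} (h : Conv t u) :
    ∃ w, Red t w ∧ Red u w := by
  have E : ∀ (Γ : List L.Ty) (τ : L.Ty),
      Equivalence (Relation.Join (Red : Raw L Γ τ → Raw L Γ τ → Prop)) := fun Γ τ =>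
    Relation.equivalence_join_reflTransGen fun a b c hab hac =>
      let ⟨w, h₁, h₂⟩ := hab.diamond hac
      ⟨w, .single h₁, .single h₂⟩
  induction h with
  | refl t => exact ⟨t, .refl, .refl⟩
  | symm _ ih => exact (E _ _).symm ih
  | trans _ _ ih₁ ih₂ => exact (E _ _).trans ih₁ ih₂
  | app _ _ ih₁ ih₂ =>
    obtain ⟨w, a, b⟩ := ih₁
    obtain ⟨w', a', b'⟩ := ih₂
    exact ⟨_, a.app a', b.app b'⟩
  | lam _ ih =>
    obtain ⟨w, a, b⟩ := ih
    exact ⟨_, a.lam, b.lam⟩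
  | beta t u => exact ⟨_, .single (.beta (.refl _) (.refl _)), .refl⟩
  | eta t => exact ⟨_, .single (.eta (.refl _)), .refl⟩

/-! ## Occurrences of variables and nominal constants -/

theorem Raw.fvars_ren {L : Lang} {Γ Δ : List L.Ty} {τ : L.Ty} (t : Raw L Γ τ) (r : Ren Γ Δ) :
    (t.ren r).fvars = t.fvars := by
  induction t generalizing Δ with
  | app t u h₁ h₂ => simp only [Raw.ren, Raw.fvars, h₁, h₂]
  | lam t h => simp only [Raw.ren, Raw.fvars, h]
  | _ => rfl

theorem Raw.noms_ren {L : Lang} {Γ Δ : List L.Ty} {τ : L.Ty} (t : Raw L Γ τ) (r : Ren Γ Δ) :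
    (t.ren r).noms = t.noms := by
  induction t generalizing Δ with
  | app t u h₁ h₂ => simp only [Raw.ren, Raw.noms, h₁, h₂]
  | lam t h => simp only [Raw.ren, Raw.noms, h]
  | _ => rfl

theorem Raw.finite_fvars {L : Lang} {Γ : List L.Ty} {τ : L.Ty} (t : Raw L Γ τ) :
    t.fvars.Finite := by
  induction t with
  | app t u h₁ h₂ => exact h₁.union h₂
  | lam t h => exact h
  | fvar x => exact Set.finite_singleton _
  | _ => exact Set.finite_empty

theorem Raw.finite_noms {L : Lang} {Γ : List L.Ty} {τ : L.Ty} (t : Raw L Γ τ) :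
    t.noms.Finite := by
  induction t with
  | app t u h₁ h₂ => exact h₁.union h₂
  | lam t h => exact h
  | nom x => exact Set.finite_singleton _
  | _ => exact Set.finite_empty

theorem Raw.fvars_bind_subset {L : Lang} {Γ Δ : List L.Ty} {τ : L.Ty} (t : Raw L Γ τ)
    (e : Env L Γ Δ) {A : Set L.Var} (hb : ∀ τ v, (e.bv τ v).fvars ⊆ A)
    (hf : ∀ x ∈ t.fvars, (e.fv x.1 x.2).fvars ⊆ A)
    (hn : ∀ a ∈ t.noms, (e.nm a.1 a.2).fvars ⊆ A) : (t.bind e).fvars ⊆ A := by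
  induction t generalizing Δ with
  | bvar v => exact hb _ v
  | fvar x => exact hf ⟨_, x⟩ rfl
  | nom a => exact hn ⟨_, a⟩ rfl
  | const c => exact Set.empty_subset _
  | app t u h₁ h₂ =>
    exact Set.union_subset (h₁ e hb (fun x hx => hf x (.inl hx)) fun a ha => hn a (.inl ha))
      (h₂ e hb (fun x hx => hf x (.inr hx)) fun a ha => hn a (.inr ha))
  | lam t h =>
    refine h (e.lift _) (fun τ v => ?_) (fun x hx => ?_) fun a ha => ?_
    · cases v with
      | here => exact Set.empty_subset _
      | there v => exact (Raw.fvars_ren _ _).trans_subset (hb _ v)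
    · exact (Raw.fvars_ren _ _).trans_subset (hf x hx)
    · exact (Raw.fvars_ren _ _).trans_subset (hn a ha)

theorem Raw.noms_bind_subset {L : Lang} {Γ Δ : List L.Ty} {τ : L.Ty} (t : Raw L Γ τ)
    (e : Env L Γ Δ) {A : Set L.Nominal} (hb : ∀ τ v, (e.bv τ v).noms ⊆ A)
    (hf : ∀ x ∈ t.fvars, (e.fv x.1 x.2).noms ⊆ A)
    (hn : ∀ a ∈ t.noms, (e.nm a.1 a.2).noms ⊆ A) : (t.bind e).noms ⊆ A := by
  induction t generalizing Δ with
  | bvar v => exact hb _ v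
  | fvar x => exact hf ⟨_, x⟩ rfl
  | nom a => exact hn ⟨_, a⟩ rfl
  | const c => exact Set.empty_subset _
  | app t u h₁ h₂ =>
    exact Set.union_subset (h₁ e hb (fun x hx => hf x (.inl hx)) fun a ha => hn a (.inl ha))
      (h₂ e hb (fun x hx => hf x (.inr hx)) fun a ha => hn a (.inr ha))
  | lam t h =>
    refine h (e.lift _) (fun τ v => ?_) (fun x hx => ?_) fun a ha => ?_
    · cases v with
      | here => exact Set.empty_subset _
      | there v => exact (Raw.noms_ren _ _).trans_subset (hb _ v)
    · exact (Raw.noms_ren _ _).trans_subset (hf x hx)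
    · exact (Raw.noms_ren _ _).trans_subset (hn a ha)

/-- Agreement is demanded only at names that occur in the term. This makes the choice of
presentations of the replacing terms immaterial. -/
theorem Raw.conv_bind {L : Lang} {Γ Δ : List L.Ty} {τ : L.Ty} (t : Raw L Γ τ)
    (e f : Env L Γ Δ) (hb : ∀ τ v, Conv (e.bv τ v) (f.bv τ v))
    (hf : ∀ x ∈ t.fvars, Conv (e.fv x.1 x.2) (f.fv x.1 x.2))
    (hn : ∀ a ∈ t.noms, Conv (e.nm a.1 a.2) (f.nm a.1 a.2)) : Conv (t.bind e) (t.bind f) := by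
  have ren : ∀ {Γ Δ : List L.Ty} {τ : L.Ty} {t u : Raw L Γ τ} (r : Ren Γ Δ), Conv t u →
      Conv (t.ren r) (u.ren r) := by
    intro Γ Δ τ t u r h
    rw [Raw.ren_eq_bind, Raw.ren_eq_bind]
    exact h.bind _
  induction t generalizing Δ with
  | bvar v => exact hb _ v
  | fvar x => exact hf ⟨_, x⟩ rfl
  | nom a => exact hn ⟨_, a⟩ rfl
  | const c => exact .refl _
  | app t u h₁ h₂ =>
    exact .app (h₁ e f hb (fun x hx => hf x (.inl hx)) fun a ha => hn a (.inl ha))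
      (h₂ e f hb (fun x hx => hf x (.inr hx)) fun a ha => hn a (.inr ha))
  | lam t h =>
    refine .lam (h (e.lift _) (f.lift _) (fun τ v => ?_) (fun x hx => ?_) fun a ha => ?_)
    · cases v with
      | here => exact .refl _
      | there v => exact ren _ (hb _ v)
    · exact ren _ (hf x hx)
    · exact ren _ (hn a ha)

theorem Par.fvars_subset {L : Lang} {Γ : List L.Ty} {τ : L.Ty} {t u : Raw L Γ τ} (h : Par t u) :
    u.fvars ⊆ t.fvars := by
  induction h with
  | app _ _ h₁ h₂ => exact Set.union_subset_union h₁ h₂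
  | lam _ h => exact h
  | beta _ _ h₁ h₂ =>
    refine Raw.fvars_bind_subset _ _ (fun τ v => ?_) (fun x hx => ?_) fun a _ => ?_
    · cases v with
      | here => exact h₂.trans Set.subset_union_right
      | there v => exact Set.empty_subset _
    · exact Set.singleton_subset_iff.2 (.inl (h₁ hx))
    · exact Set.empty_subset _
  | eta _ h =>
    refine h.trans (Set.Subset.trans ?_ Set.subset_union_left)
    rw [Raw.fvars_ren]
  | _ => exact subset_rfl

theorem Par.noms_subset {L : Lang} {Γ : List L.Ty} {τ : L.Ty} {t u : Raw L Γ τ} (h : Par t u) :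
    u.noms ⊆ t.noms := by
  induction h with
  | app _ _ h₁ h₂ => exact Set.union_subset_union h₁ h₂
  | lam _ h => exact h
  | beta _ _ h₁ h₂ =>
    refine Raw.noms_bind_subset _ _ (fun τ v => ?_) (fun x _ => ?_) fun a ha => ?_
    · cases v with
      | here => exact h₂.trans Set.subset_union_right
      | there v => exact Set.empty_subset _
    · exact Set.empty_subset _
    · exact Set.singleton_subset_iff.2 (.inl (h₁ ha))
  | eta _ h =>
    refine h.trans (Set.Subset.trans ?_ Set.subset_union_left)
    rw [Raw.noms_ren]
  | _ => exact subset_rfl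

theorem Red.fvars_subset {L : Lang} {Γ : List L.Ty} {τ : L.Ty} {t u : Raw L Γ τ} (h : Red t u) :
    u.fvars ⊆ t.fvars := by
  induction h with
  | refl => exact subset_rfl
  | tail _ h ih => exact h.fvars_subset.trans ih

theorem Red.noms_subset {L : Lang} {Γ : List L.Ty} {τ : L.Ty} {t u : Raw L Γ τ} (h : Red t u) :
    u.noms ⊆ t.noms := by
  induction h with
  | refl => exact subset_rfl
  | tail _ h ih => exact h.noms_subset.trans ih

/-! ### Free variables and support of terms -/

theorem Term.mk_eq_mk {L : Lang} {τ : L.Ty} {r s : Raw L [] τ} :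
    Term.mk r = Term.mk s ↔ Conv r s :=
  ⟨fun h => Quotient.exact h, fun h => Quotient.sound h⟩

theorem Term.exists_mk {L : Lang} {τ : L.Ty} (t : Term L τ) : ∃ r, Term.mk r = t :=
  Quotient.exists_rep t

theorem Term.mk_out {L : Lang} {τ : L.Ty} (t : Term L τ) :
    Term.mk (Quotient.out (s := convSetoid L [] τ) t) = t :=
  Quotient.out_eq (s := convSetoid L [] τ) t

/-- A term is presented by a lambda-term in which just its free variables and the nominal
constants of its support occur. -/
theorem Term.exists_exact {L : Lang} {τ : L.Ty} (t : Term L τ) :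
    ∃ r : Raw L [] τ, Term.mk r = t ∧ r.fvars = t.fvars ∧ r.noms = t.supp := by
  classical
  -- Take a presentation with the fewest names. It has a common reduct with any other presentation;
  -- reduction only loses names, and by minimality this reduct still has all of the chosen ones, so
  -- they occur in the other presentation too.
  let P : ℕ → Prop := fun n => ∃ r : Raw L [] τ, Term.mk r = t ∧ r.fvars.ncard + r.noms.ncard = n
  have hP : ∃ n, P n := by
    obtain ⟨r, hr⟩ := t.exists_mk
    exact ⟨_, r, hr, rfl⟩
  obtain ⟨r, hr, hn⟩ := Nat.find_spec hP
  have key : ∀ s : Raw L [] τ, Term.mk s = t → r.fvars ⊆ s.fvars ∧ r.noms ⊆ s.noms := by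
    intro s hs
    obtain ⟨w, h₁, h₂⟩ := (Term.mk_eq_mk.1 (hr.trans hs.symm)).join
    have hw : Term.mk w = t := (Term.mk_eq_mk.2 h₁.conv).symm.trans hr
    have hmin : Nat.find hP ≤ w.fvars.ncard + w.noms.ncard := Nat.find_min' hP ⟨w, hw, rfl⟩
    have a := Set.ncard_le_ncard h₁.fvars_subset r.finite_fvars
    have b := Set.ncard_le_ncard h₁.noms_subset r.finite_noms
    have c := Set.eq_of_subset_of_ncard_le h₁.fvars_subset (by omega) r.finite_fvars
    have d := Set.eq_of_subset_of_ncard_le h₁.noms_subset (by omega) r.finite_noms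
    exact ⟨c ▸ h₂.fvars_subset, d ▸ h₂.noms_subset⟩
  exact ⟨r, hr, Set.Subset.antisymm (fun x hx s hs => (key s hs).1 hx) fun x hx => hx r hr,
    Set.Subset.antisymm (fun x hx s hs => (key s hs).2 hx) fun x hx => hx r hr⟩

theorem Term.fvars_mk_subset {L : Lang} {τ : L.Ty} (r : Raw L [] τ) :
    (Term.mk r).fvars ⊆ r.fvars := fun _ h => h r rfl

theorem Term.supp_mk_subset {L : Lang} {τ : L.Ty} (r : Raw L [] τ) :
    (Term.mk r).supp ⊆ r.noms := fun _ h => h r rfl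

theorem Term.finite_fvars {L : Lang} {τ : L.Ty} (t : Term L τ) : t.fvars.Finite := by
  obtain ⟨r, -, h, -⟩ := t.exists_exact
  exact h ▸ r.finite_fvars

theorem Term.finite_supp {L : Lang} {τ : L.Ty} (t : Term L τ) : t.supp.Finite := by
  obtain ⟨r, -, -, h⟩ := t.exists_exact
  exact h ▸ r.finite_noms

theorem Term.fvars_var {L : Lang} {τ : L.Ty} (x : EVar τ) :
    (Term.var (L := L) x).fvars = {⟨τ, x⟩} := by
  refine (Term.fvars_mk_subset _).antisymm (Set.singleton_subset_iff.2 fun s hs => ?_)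
  obtain ⟨w, h₁, h₂⟩ := (Term.mk_eq_mk.1 hs).join
  -- A variable reduces only to itself, so every presentation of it reduces to it.
  have : w = .fvar x := by
    clear h₁
    induction h₂ with
    | refl => rfl
    | tail _ h ih => subst ih; cases h; rfl
  subst this
  exact h₁.fvars_subset rfl

theorem Term.supp_var {L : Lang} {τ : L.Ty} (x : EVar τ) : (Term.var (L := L) x).supp = ∅ :=
  Set.subset_empty_iff.1 (Term.supp_mk_subset _)

theorem Term.fvars_nom {L : Lang} {τ : L.Ty} (a : L.Nom τ) : (Term.nom a).fvars = ∅ :=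
  Set.subset_empty_iff.1 (Term.fvars_mk_subset _)

theorem Term.supp_nom_subset {L : Lang} {τ : L.Ty} (a : L.Nom τ) : (Term.nom a).supp ⊆ {⟨τ, a⟩} :=
  Term.supp_mk_subset _

theorem Term.fvars_const {L : Lang} {τ : L.Ty} (c : Const L τ) : (Term.const c).fvars = ∅ :=
  Set.subset_empty_iff.1 (Term.fvars_mk_subset _)

theorem Term.supp_const {L : Lang} {τ : L.Ty} (c : Const L τ) : (Term.const c).supp = ∅ :=
  Set.subset_empty_iff.1 (Term.supp_mk_subset _)

theorem Term.fvars_app_subset {L : Lang} {σ τ : L.Ty} (t : Term L (.arr σ τ)) (u : Term L σ) :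
    (t.app u).fvars ⊆ t.fvars ∪ u.fvars := by
  obtain ⟨r, rfl, hr, -⟩ := t.exists_exact
  obtain ⟨s, rfl, hs, -⟩ := u.exists_exact
  rw [← hr, ← hs]
  exact Term.fvars_mk_subset (.app r s)

theorem Term.supp_app_subset {L : Lang} {σ τ : L.Ty} (t : Term L (.arr σ τ)) (u : Term L σ) :
    (t.app u).supp ⊆ t.supp ∪ u.supp := by
  obtain ⟨r, rfl, -, hr⟩ := t.exists_exact
  obtain ⟨s, rfl, -, hs⟩ := u.exists_exact
  rw [← hr, ← hs]
  exact Term.supp_mk_subset (.app r s)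

theorem Term.fvars_apps_subset {L : Lang} {τ : L.Ty} {A : Set L.Var} {ts : List L.Ty}
    (t : Term L (arrows ts τ)) (us : HL (Term L) ts) (ht : t.fvars ⊆ A)
    (hu : ∀ p ∈ us.toList, p.2.fvars ⊆ A) : (t.apps us).fvars ⊆ A := by
  induction us with
  | nil => exact ht
  | cons u us ih =>
    simp only [HL.toList, List.mem_cons, forall_eq_or_imp] at hu
    exact ih _ ((t.fvars_app_subset u).trans (Set.union_subset ht hu.1)) hu.2

theorem Term.supp_apps_subset {L : Lang} {τ : L.Ty} {A : Set L.Nominal} {ts : List L.Ty}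
    (t : Term L (arrows ts τ)) (us : HL (Term L) ts) (ht : t.supp ⊆ A)
    (hu : ∀ p ∈ us.toList, p.2.supp ⊆ A) : (t.apps us).supp ⊆ A := by
  induction us with
  | nil => exact ht
  | cons u us ih =>
    simp only [HL.toList, List.mem_cons, forall_eq_or_imp] at hu
    exact ih _ ((t.supp_app_subset u).trans (Set.union_subset ht hu.1)) hu.2

/-! ### Terms headed by a constant -/

/-- Lambda-terms that consist of a constant applied to arguments. -/
inductive Raw.ConstHeaded {L : Lang} {Γ : List L.Ty} : {τ : L.Ty} → Raw L Γ τ → Prop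
  | const {τ : L.Ty} (c : Const L τ) : ConstHeaded (.const c)
  | app {σ τ : L.Ty} {t : Raw L Γ (.arr σ τ)} (h : ConstHeaded t) (u : Raw L Γ σ) :
      ConstHeaded (.app t u)

theorem Par.constHeaded {L : Lang} {Γ : List L.Ty} {τ : L.Ty} {t u : Raw L Γ τ} (h : Par t u)
    (ht : t.ConstHeaded) : u.ConstHeaded := by
  induction ht with
  | const c => cases h; exact .const c
  | app ht _ ih =>
    cases h with
    | app h₁ h₂ => exact .app (ih h₁) _
    | beta => cases ht

/-- A constant at the head rules out beta at the root, so function and argument reduce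
independently. -/
theorem Red.of_app {L : Lang} {Γ : List L.Ty} {σ τ : L.Ty} {t : Raw L Γ (.arr σ τ)}
    {u : Raw L Γ σ} {w : Raw L Γ τ} (h : Red (.app t u) w) (ht : t.ConstHeaded) :
    ∃ t' u', w = .app t' u' ∧ t'.ConstHeaded ∧ Red t t' ∧ Red u u' := by
  induction h with
  | refl => exact ⟨t, u, rfl, ht, .refl, .refl⟩
  | tail _ h ih =>
    obtain ⟨t', u', rfl, a, b, c⟩ := ih
    cases h with
    | app h₁ h₂ => exact ⟨_, _, rfl, h₁.constHeaded a, b.tail h₁, c.tail h₂⟩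
    | beta => cases a

/-- Terms that consist of a constant applied to arguments. -/
def Term.ConstHeaded {L : Lang} {τ : L.Ty} (t : Term L τ) : Prop :=
  ∃ r : Raw L [] τ, Term.mk r = t ∧ r.ConstHeaded

theorem Term.constHeaded_const {L : Lang} {τ : L.Ty} (c : Const L τ) :
    (Term.const c).ConstHeaded :=
  ⟨_, rfl, .const c⟩

theorem Term.ConstHeaded.app {L : Lang} {σ τ : L.Ty} {t : Term L (.arr σ τ)}
    (h : t.ConstHeaded) (u : Term L σ) : (t.app u).ConstHeaded := by
  obtain ⟨r, rfl, h⟩ := h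
  obtain ⟨s, rfl⟩ := u.exists_mk
  exact ⟨_, rfl, h.app s⟩

theorem Term.ConstHeaded.exists_app {L : Lang} {σ τ : L.Ty} {t : Term L (.arr σ τ)}
    (h : t.ConstHeaded) (u : Term L σ) (r : Raw L [] τ) (hr : Term.mk r = t.app u) :
    ∃ t' u', Term.mk t' = t ∧ Term.mk u' = u ∧ t'.fvars ∪ u'.fvars ⊆ r.fvars ∧
      t'.noms ∪ u'.noms ⊆ r.noms := by
  obtain ⟨p, rfl, h⟩ := h
  obtain ⟨s, rfl⟩ := u.exists_mk
  obtain ⟨w, h₁, h₂⟩ := (Term.mk_eq_mk (s := .app p s).1 hr).join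
  obtain ⟨t', u', rfl, -, a, b⟩ := h₂.of_app h
  exact ⟨t', u', (Term.mk_eq_mk.2 a.conv).symm, (Term.mk_eq_mk.2 b.conv).symm,
    h₁.fvars_subset, h₁.noms_subset⟩

theorem Term.ConstHeaded.fvars_app {L : Lang} {σ τ : L.Ty} {t : Term L (.arr σ τ)}
    (h : t.ConstHeaded) (u : Term L σ) : (t.app u).fvars = t.fvars ∪ u.fvars := by
  refine (t.fvars_app_subset u).antisymm fun x hx r hr => ?_
  obtain ⟨t', u', rfl, rfl, h₁, -⟩ := h.exists_app u r hr
  exact h₁ (hx.imp (fun h => h _ rfl) fun h => h _ rfl)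

/-- Arbitrary applications satisfy only the inclusion, since beta may erase the argument; below a
constant nothing is erased. The equality is what allows the permutation chosen for a compound
formula to be used for its parts. -/
theorem Term.ConstHeaded.supp_app {L : Lang} {σ τ : L.Ty} {t : Term L (.arr σ τ)}
    (h : t.ConstHeaded) (u : Term L σ) : (t.app u).supp = t.supp ∪ u.supp := by
  refine (t.supp_app_subset u).antisymm fun x hx r hr => ?_
  obtain ⟨t', u', rfl, rfl, -, h₁⟩ := h.exists_app u r hr
  exact h₁ (hx.imp (fun h => h _ rfl) fun h => h _ rfl)

theorem Term.ConstHeaded.subset_supp_apps {L : Lang} {τ : L.Ty} {ts : List L.Ty}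
    {t : Term L (arrows ts τ)} (h : t.ConstHeaded) (us : HL (Term L) ts) :
    t.supp ⊆ (t.apps us).supp ∧ ∀ p ∈ us.toList, p.2.supp ⊆ (t.apps us).supp := by
  induction us with
  | nil => exact ⟨subset_rfl, by simp [HL.toList]⟩
  | cons u us ih =>
    obtain ⟨h₁, h₂⟩ := ih (h.app u)
    rw [h.supp_app, Set.union_subset_iff] at h₁
    refine ⟨h₁.1, ?_⟩
    simp only [HL.toList, List.mem_cons, forall_eq_or_imp]
    exact ⟨h₁.2, h₂⟩

/-! ### Simultaneous replacement in terms -/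

/-- Simultaneous replacement of the free variables and the nominal constants of a term. -/
noncomputable def Term.sb {L : Lang} {τ : L.Ty} (f : ∀ τ : L.Ty, EVar τ → Term L τ)
    (g : ∀ τ : L.Ty, L.Nom τ → Term L τ) (t : Term L τ) : Term L τ :=
  Quotient.map (sa := convSetoid L [] τ) (sb := convSetoid L [] τ)
    (Raw.bind ⟨fun _ v => .bvar v, fun τ x => Quotient.out (s := convSetoid L [] τ) (f τ x),
      fun τ a => Quotient.out (s := convSetoid L [] τ) (g τ a)⟩)
    (fun _ _ h => Conv.bind h _) t

/-- Any presentation of the replacing terms computes the replacement, so later arguments can choose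
a convenient one. -/
theorem Term.sb_mk {L : Lang} {τ : L.Ty} {f : ∀ τ : L.Ty, EVar τ → Term L τ}
    {g : ∀ τ : L.Ty, L.Nom τ → Term L τ} (r : Raw L [] τ) (e : Env L [] [])
    (hf : ∀ x ∈ r.fvars, Term.mk (e.fv x.1 x.2) = f x.1 x.2)
    (hg : ∀ a ∈ r.noms, Term.mk (e.nm a.1 a.2) = g a.1 a.2) :
    (Term.mk r).sb f g = Term.mk (r.bind e) := by
  refine Term.mk_eq_mk.2 (Raw.conv_bind r _ _ (fun τ v => nomatch v) (fun x hx => ?_)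
    fun a ha => ?_)
  · exact Term.mk_eq_mk.1 ((Term.mk_out _).trans (hf x hx).symm)
  · exact Term.mk_eq_mk.1 ((Term.mk_out _).trans (hg a ha).symm)

theorem Term.sb_congr {L : Lang} {τ : L.Ty} {f f' : ∀ τ : L.Ty, EVar τ → Term L τ}
    {g g' : ∀ τ : L.Ty, L.Nom τ → Term L τ} (t : Term L τ)
    (hf : ∀ x ∈ t.fvars, f x.1 x.2 = f' x.1 x.2) (hg : ∀ a ∈ t.supp, g a.1 a.2 = g' a.1 a.2) :
    t.sb f g = t.sb f' g' := by
  obtain ⟨r, rfl, h₁, h₂⟩ := t.exists_exact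
  refine Term.sb_mk r _ (fun x hx => ?_) fun a ha => ?_
  · exact (Term.mk_out _).trans (hf x (h₁ ▸ hx)).symm
  · exact (Term.mk_out _).trans (hg a (h₂ ▸ ha)).symm

theorem Term.sb_sb {L : Lang} {τ : L.Ty} (f f' : ∀ τ : L.Ty, EVar τ → Term L τ)
    (g g' : ∀ τ : L.Ty, L.Nom τ → Term L τ) (t : Term L τ) :
    (t.sb f' g').sb f g = t.sb (fun τ x => (f' τ x).sb f g) fun τ a => (g' τ a).sb f g := by
  obtain ⟨r, rfl⟩ := t.exists_mk
  symm
  refine (Term.sb_mk r _ (fun x _ => ?_) fun a _ => ?_).trans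
    (congrArg Term.mk (Raw.bind_bind r _ _)).symm
  · conv_rhs => rw [← Term.mk_out (f' x.1 x.2)]
    rfl
  · conv_rhs => rw [← Term.mk_out (g' a.1 a.2)]
    rfl

theorem Term.sb_id {L : Lang} {τ : L.Ty} (t : Term L τ) :
    t.sb (fun _ x => .var x) (fun _ a => .nom a) = t := by
  obtain ⟨r, rfl⟩ := t.exists_mk
  exact (Term.sb_mk r ⟨fun _ v => .bvar v, fun _ x => .fvar x, fun _ a => .nom a⟩
    (fun _ _ => rfl) fun _ _ => rfl).trans (congrArg _ (Raw.bind_id r))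

theorem Term.sb_app {L : Lang} {σ τ : L.Ty} (f : ∀ τ : L.Ty, EVar τ → Term L τ)
    (g : ∀ τ : L.Ty, L.Nom τ → Term L τ) (t : Term L (.arr σ τ)) (u : Term L σ) :
    (t.app u).sb f g = (t.sb f g).app (u.sb f g) := by
  obtain ⟨r, rfl⟩ := t.exists_mk
  obtain ⟨s, rfl⟩ := u.exists_mk
  rfl

theorem Term.sb_var {L : Lang} {τ : L.Ty} (f : ∀ τ : L.Ty, EVar τ → Term L τ)
    (g : ∀ τ : L.Ty, L.Nom τ → Term L τ) (x : EVar τ) :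
    (Term.var x).sb f g = f τ x := Term.mk_out _

theorem Term.sb_nom {L : Lang} {τ : L.Ty} (f : ∀ τ : L.Ty, EVar τ → Term L τ)
    (g : ∀ τ : L.Ty, L.Nom τ → Term L τ) (a : L.Nom τ) :
    (Term.nom a).sb f g = g τ a := Term.mk_out _

theorem Term.sb_apps {L : Lang} {τ : L.Ty} (f : ∀ τ : L.Ty, EVar τ → Term L τ)
    (g : ∀ τ : L.Ty, L.Nom τ → Term L τ) {ts : List L.Ty} (t : Term L (arrows ts τ))
    (us : HL (Term L) ts) :
    (t.apps us).sb f g = (t.sb f g).apps (us.map fun _ u => u.sb f g) := by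
  induction us with
  | nil => rfl
  | cons u us ih =>
    exact (ih _).trans (congrArg (fun v => Term.apps v _) (Term.sb_app f g t u))

/-- Exact presentations of the term and of all the replacing terms bound the occurrences in the
result by free variables and supports alone. -/
theorem Term.sb_subset {L : Lang} {τ : L.Ty} {f : ∀ τ : L.Ty, EVar τ → Term L τ}
    {g : ∀ τ : L.Ty, L.Nom τ → Term L τ} (t : Term L τ) :
    ∃ r : Raw L [] τ, Term.mk r = t.sb f g ∧
      (∀ A, (∀ x ∈ t.fvars, (f x.1 x.2).fvars ⊆ A) → (∀ a ∈ t.supp, (g a.1 a.2).fvars ⊆ A) →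
        r.fvars ⊆ A) ∧
      ∀ A, (∀ x ∈ t.fvars, (f x.1 x.2).supp ⊆ A) → (∀ a ∈ t.supp, (g a.1 a.2).supp ⊆ A) →
        r.noms ⊆ A := by
  obtain ⟨r, rfl, h₁, h₂⟩ := t.exists_exact
  choose e he using fun τ : L.Ty => fun t : Term L τ => t.exists_exact
  refine ⟨_, (Term.sb_mk r ⟨fun _ v => .bvar v, fun τ x => e τ (f τ x), fun τ a => e τ (g τ a)⟩
    (fun x _ => (he _ _).1) fun a _ => (he _ _).1).symm, fun A hf hg => ?_, fun A hf hg => ?_⟩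
  · refine Raw.fvars_bind_subset _ _ (fun τ v => nomatch v) (fun x hx => ?_) fun a ha => ?_
    · exact (he _ _).2.1.trans_subset (hf x (h₁ ▸ hx))
    · exact (he _ _).2.1.trans_subset (hg a (h₂ ▸ ha))
  · refine Raw.noms_bind_subset _ _ (fun τ v => nomatch v) (fun x hx => ?_) fun a ha => ?_
    · exact (he _ _).2.2.trans_subset (hf x (h₁ ▸ hx))
    · exact (he _ _).2.2.trans_subset (hg a (h₂ ▸ ha))

theorem Term.fvars_sb_subset {L : Lang} {τ : L.Ty} {f : ∀ τ : L.Ty, EVar τ → Term L τ}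
    {g : ∀ τ : L.Ty, L.Nom τ → Term L τ} (t : Term L τ) {A : Set L.Var}
    (hf : ∀ x ∈ t.fvars, (f x.1 x.2).fvars ⊆ A) (hg : ∀ a ∈ t.supp, (g a.1 a.2).fvars ⊆ A) :
    (t.sb f g).fvars ⊆ A := by
  obtain ⟨r, hr, h, -⟩ := t.sb_subset (f := f) (g := g)
  exact hr ▸ (Term.fvars_mk_subset r).trans (h A hf hg)

theorem Term.supp_sb_subset {L : Lang} {τ : L.Ty} {f : ∀ τ : L.Ty, EVar τ → Term L τ}
    {g : ∀ τ : L.Ty, L.Nom τ → Term L τ} (t : Term L τ) {A : Set L.Nominal}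
    (hf : ∀ x ∈ t.fvars, (f x.1 x.2).supp ⊆ A) (hg : ∀ a ∈ t.supp, (g a.1 a.2).supp ⊆ A) :
    (t.sb f g).supp ⊆ A := by
  obtain ⟨r, hr, -, h⟩ := t.sb_subset (f := f) (g := g)
  exact hr ▸ (Term.supp_mk_subset r).trans (h A hf hg)

/-! ### Abstraction of nominal constants -/

open Classical in
/-- The replacement of a nominal constant by a new bound variable. -/
noncomputable def Env.absNom {L : Lang} {σ : L.Ty} (c : L.Nom σ) : Env L [] [σ] where
  bv := fun _ v => .bvar (.there v)
  fv := fun _ x => .fvar x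
  nm := fun τ a =>
    Function.update (fun d : L.Nominal => (Raw.nom d.2 : Raw L [σ] d.1)) ⟨σ, c⟩ (.bvar .here) ⟨τ, a⟩

theorem Env.absNom_self {L : Lang} {σ : L.Ty} (c : L.Nom σ) :
    (Env.absNom c).nm σ c = .bvar .here := by
  simp [Env.absNom]

theorem Env.absNom_of_ne {L : Lang} {σ : L.Ty} (c : L.Nom σ) {a : L.Nominal} (h : a ≠ ⟨σ, c⟩) :
    (Env.absNom c).nm a.1 a.2 = .nom a.2 := by
  classical
  exact Function.update_of_ne h (Raw.bvar Mem.here)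
    fun d : L.Nominal => (Raw.nom d.2 : Raw L [σ] d.1)

/-- `λc.t`, for a term `t`. -/
noncomputable def Term.absNom {L : Lang} {σ τ : L.Ty} (c : L.Nom σ) (t : Term L τ) :
    Term L (.arr σ τ) :=
  Quotient.map (sa := convSetoid L [] τ) (sb := convSetoid L [] (.arr σ τ))
    (Raw.absNom c) (fun _ _ h => Conv.lam (Conv.bind h _)) t

/-- `λc₁ ⋯ λcₙ.t`, for a term `t`. -/
noncomputable def Term.absNoms {L : Lang} {τ : L.Ty} (t : Term L τ) :
    {ts : List L.Ty} → HL L.Nom ts → Term L (arrows ts τ)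
  | _, .nil => t
  | _, .cons c cs => Term.absNom c (t.absNoms cs)

theorem Term.mk_absNoms {L : Lang} {τ : L.Ty} {ts : List L.Ty} (r : Raw L [] τ)
    (cs : HL L.Nom ts) : Term.mk (r.absNoms cs) = (Term.mk r).absNoms cs := by
  induction cs with
  | nil => rfl
  | cons c cs ih => exact congrArg (Term.absNom c) ih

theorem naHolds_iff {L : Lang} {ts : List L.Ty} {τ : L.Ty} {s : Term L (arrows ts τ)}
    {t : Term L τ} : NaHolds s t ↔ ∃ cs : HL L.Nom ts, cs.toList.Nodup ∧ s = t.absNoms cs := by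
  constructor
  · rintro ⟨cs, h, r, rfl, rfl⟩
    exact ⟨cs, h, Term.mk_absNoms r cs⟩
  · rintro ⟨cs, h, rfl⟩
    obtain ⟨r, rfl⟩ := t.exists_mk
    exact ⟨cs, h, r, rfl, (Term.mk_absNoms r cs).symm⟩

/-- Beta sends the bound variable that stands for c back to c. -/
theorem Term.absNom_app {L : Lang} {σ τ : L.Ty} (c : L.Nom σ) (t : Term L τ) :
    (t.absNom c).app (.nom c) = t := by
  obtain ⟨r, rfl⟩ := t.exists_mk
  refine Term.mk_eq_mk.2 (.trans (.beta (r.bind (Env.absNom c)) _) ?_)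
  rw [Raw.bind_bind]
  conv => rhs; rw [← Raw.bind_id r]
  refine Raw.conv_bind r _ _ (fun τ v => nomatch v) (fun x _ => .refl _) fun a _ => ?_
  by_cases h : a = ⟨σ, c⟩
  · subst h
    simp only [Env.absNom_self]
    exact .refl _
  · simp only [Env.absNom_of_ne c h]
    exact .refl _

theorem Term.absNoms_apps {L : Lang} {τ : L.Ty} {ts : List L.Ty} (cs : HL L.Nom ts)
    (t : Term L τ) : (t.absNoms cs).apps (nomTerms cs) = t := by
  induction cs with
  | nil => rfl
  | cons c cs ih =>
    simp only [nomTerms, HL.map, Term.apps, Term.absNoms, Term.absNom_app] at ih ⊢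
    exact ih

theorem Term.fvars_absNom_subset {L : Lang} {σ τ : L.Ty} (c : L.Nom σ) (t : Term L τ) :
    (t.absNom c).fvars ⊆ t.fvars := by
  obtain ⟨r, rfl, h, -⟩ := t.exists_exact
  refine (Term.fvars_mk_subset _).trans (h ▸ ?_)
  refine Raw.fvars_bind_subset r (Env.absNom c) (fun τ v => nomatch v)
    (fun x hx => ?_) fun a _ => ?_
  · exact Set.singleton_subset_iff.2 hx
  · by_cases h : a = ⟨σ, c⟩
    · subst h
      simp [Env.absNom_self, Raw.fvars]
    · simp [Env.absNom_of_ne c h, Raw.fvars]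

theorem Term.supp_absNom_subset {L : Lang} {σ τ : L.Ty} (c : L.Nom σ) (t : Term L τ) :
    (t.absNom c).supp ⊆ t.supp \ {⟨σ, c⟩} := by
  obtain ⟨r, rfl, -, h⟩ := t.exists_exact
  refine (Term.supp_mk_subset _).trans (h ▸ ?_)
  refine Raw.noms_bind_subset r (Env.absNom c) (fun τ v => nomatch v)
    (fun x hx => ?_) fun a ha => ?_
  · exact Set.empty_subset _
  · by_cases h : a = ⟨σ, c⟩
    · subst h
      simp [Env.absNom_self, Raw.noms]
    · simp [Env.absNom_of_ne c h, Raw.noms, ha, h]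

theorem Term.fvars_absNoms_subset {L : Lang} {τ : L.Ty} {ts : List L.Ty} (cs : HL L.Nom ts)
    (t : Term L τ) : (t.absNoms cs).fvars ⊆ t.fvars := by
  induction cs with
  | nil => exact subset_rfl
  | cons c cs ih => exact (Term.fvars_absNom_subset c _).trans ih

theorem Term.supp_absNoms_subset {L : Lang} {τ : L.Ty} {ts : List L.Ty} (cs : HL L.Nom ts)
    (t : Term L τ) : (t.absNoms cs).supp ⊆ t.supp \ {a | a ∈ cs.toList} := by
  induction cs with
  | nil =>
    intro a ha
    exact ⟨ha, by simp [HL.toList]⟩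
  | cons c cs ih =>
    intro a ha
    obtain ⟨h₁, h₂⟩ := Term.supp_absNom_subset c _ ha
    obtain ⟨h₃, h₄⟩ := ih h₁
    refine ⟨h₃, ?_⟩
    simp only [HL.toList, List.mem_cons, Set.mem_ofPred_eq, not_or]
    exact ⟨h₂, h₄⟩

/-! ## Permutations of nominal constants -/

/-- The identity permutation. -/
def NPerm.refl (L : Lang) : NPerm L where
  toEquiv _ := .refl _
  finite_moved := by simp

/-- Composition: first `π'`, then `π`. -/
def NPerm.comp {L : Lang} (π π' : NPerm L) : NPerm L where
  toEquiv τ := (π'.toEquiv τ).trans (π.toEquiv τ)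
  finite_moved := by
    refine (π.finite_moved.union π'.finite_moved).subset fun a ha => ?_
    by_contra h
    simp only [Set.mem_union, Set.mem_ofPred_eq, not_or, not_not] at h
    exact ha (by simp [h.1, h.2])

theorem NPerm.onNom_injective {L : Lang} (π : NPerm L) : Function.Injective π.onNom := by
  rintro ⟨σ, a⟩ ⟨τ, b⟩ h
  simp only [NPerm.onNom, Sigma.mk.injEq] at h
  obtain ⟨rfl, h⟩ := h
  rw [(π.toEquiv σ).injective (eq_of_heq h)]

theorem NPerm.toEquiv_eq {L : Lang} {π π' : NPerm L} {a : L.Nominal} (h : π.onNom a = π'.onNom a) :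
    π.toEquiv a.1 a.2 = π'.toEquiv a.1 a.2 := by
  simpa [NPerm.onNom] using h

theorem Lang.nabTy_of_nom {L : Lang} {τ : L.Ty} (a : L.Nom τ) : L.NabTy τ := by
  by_contra h
  exact (L.nom_empty τ h).elim a

/-- A type-preserving map that is injective on a finite set of nominal constants extends to a
permutation. -/
theorem NPerm.exists_extend {L : Lang} {X : Set L.Nominal} (hX : X.Finite)
    (f : ∀ τ, L.Nom τ → L.Nom τ) (hf : ∀ τ a b, ⟨τ, a⟩ ∈ X → ⟨τ, b⟩ ∈ X → f τ a = f τ b → a = b) :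
    ∃ π : NPerm L, ∀ τ a, ⟨τ, a⟩ ∈ X → π.toEquiv τ a = f τ a := by
  classical
  induction X, hX using Set.Finite.induction_on with
  | empty => exact ⟨.refl L, by simp⟩
  | @insert c X hc _ ih =>
    obtain ⟨π, hπ⟩ := ih fun τ a b ha hb => hf τ a b (.inr ha) (.inr hb)
    obtain ⟨σ, c⟩ := c
    -- Follow the permutation obtained for X by the transposition of π(c) and f(c). It corrects the
    -- value at c; by injectivity neither of the two is a value on the other points of X, so these
    -- are undisturbed.
    let s : NPerm L :=
      { toEquiv := Function.update (fun _ => .refl _) σ (Equiv.swap (π.toEquiv σ c) (f σ c))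
        finite_moved := by
          refine (Set.toFinite {⟨σ, π.toEquiv σ c⟩, ⟨σ, f σ c⟩}).subset ?_
          rintro ⟨τ, a⟩ ha
          by_cases h : τ = σ
          · subst h
            simp only [Set.mem_ofPred_eq, Function.update_self] at ha
            by_contra h'
            simp only [Set.mem_insert_iff, Sigma.mk.injEq, heq_eq_eq, true_and,
              Set.mem_singleton_iff, not_or] at h'
            exact ha (Equiv.swap_apply_of_ne_of_ne h'.1 h'.2)
          · simp [Function.update_of_ne h] at ha }
    refine ⟨s.comp π, fun τ a ha => ?_⟩
    by_cases h : τ = σ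
    · subst h
      simp only [NPerm.comp, s, Function.update_self, Equiv.trans_apply]
      by_cases hac : a = c
      · subst hac
        exact Equiv.swap_apply_left _ _
      · have ha' : ⟨τ, a⟩ ∈ X := by
          rcases ha with h | h
          · simp only [Sigma.mk.injEq, heq_eq_eq, true_and] at h
            exact absurd h hac
          · exact h
        rw [Equiv.swap_apply_of_ne_of_ne, hπ τ a ha']
        · exact fun h => hac ((π.toEquiv τ).injective h)
        · rw [hπ τ a ha']
          exact fun h => hac (hf τ a c (.inr ha') (.inl rfl) h)
    · simp only [NPerm.comp, s, Function.update_of_ne h, Equiv.trans_apply, Equiv.refl_apply]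
      refine hπ τ a (ha.resolve_left ?_)
      rintro ⟨⟩
      exact h rfl

/-- A permutation can be changed outside a set `K` in such a way that it maps the elements of a
finite set that are not in `K` to fresh nominal constants. -/
theorem NPerm.exists_fresh {L : Lang} (π : NPerm L) {K Y F : Set L.Nominal} (hK : K.Finite)
    (hY : Y.Finite) (hF : F.Finite) :
    ∃ π' : NPerm L, (∀ a ∈ K, π'.onNom a = π.onNom a) ∧ ∀ a ∈ Y, a ∉ K → π'.onNom a ∉ F := by
  classical
  -- At each type that has nominal constants there are infinitely many, so the finite set Y injects
  -- into the complement of F and π(K).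
  have hg : ∀ τ, ∃ g : L.Nom τ → L.Nom τ, (∀ a, ⟨τ, a⟩ ∈ Y → ⟨τ, g a⟩ ∉ F ∪ π.onNom '' K) ∧
      Set.InjOn g {a | ⟨τ, a⟩ ∈ Y} := by
    intro τ
    rcases isEmpty_or_nonempty (L.Nom τ) with h | ⟨⟨a⟩⟩
    · exact ⟨id, fun a => h.elim a, Set.injOn_id _⟩
    · have := L.nom_infinite τ (Lang.nabTy_of_nom a)
      have : Nonempty (L.Nom τ) := ⟨a⟩
      have inj : Function.Injective (Sigma.mk τ : L.Nom τ → L.Nominal) := sigma_mk_injective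
      have h₁ : {a : L.Nom τ | ⟨τ, a⟩ ∈ Y}.Finite := hY.preimage inj.injOn
      have h₂ : ({a : L.Nom τ | ⟨τ, a⟩ ∈ F ∪ π.onNom '' K}ᶜ).Infinite :=
        ((hF.union (hK.image _)).preimage inj.injOn).infinite_compl
      obtain ⟨g, hg₁, hg₂⟩ := h₁.exists_injOn_of_encard_le
        (t := {a : L.Nom τ | ⟨τ, a⟩ ∈ F ∪ π.onNom '' K}ᶜ)
        (by rw [h₂.encard_eq]; exact le_top)
      exact ⟨g, fun a ha => hg₁ ha, hg₂⟩
  choose g hg₁ hg₂ using hg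
  -- Use π on K and g on the rest of Y. The values of g avoid π(K), so the combined map is
  -- injective.
  obtain ⟨π', hπ'⟩ := NPerm.exists_extend (hK.union hY)
    (fun τ a => if (⟨τ, a⟩ : L.Nominal) ∈ K then π.toEquiv τ a else g τ a) (by
      have mixed : ∀ τ a b, (⟨τ, a⟩ : L.Nominal) ∈ K → (⟨τ, b⟩ : L.Nominal) ∈ Y →
          π.toEquiv τ a ≠ g τ b := fun τ a b ha hb h =>
        hg₁ τ b hb (.inr ⟨⟨τ, a⟩, ha, by simp [NPerm.onNom, h]⟩)
      intro τ a b ha hb h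
      by_cases ha' : (⟨τ, a⟩ : L.Nominal) ∈ K <;> by_cases hb' : (⟨τ, b⟩ : L.Nominal) ∈ K <;>
        simp only [ha', hb', if_true, if_false] at h
      · exact (π.toEquiv τ).injective h
      · exact absurd h (mixed τ a b ha' (hb.resolve_left hb'))
      · exact absurd h.symm (mixed τ b a hb' (ha.resolve_left ha'))
      · exact hg₂ τ (ha.resolve_left ha') (hb.resolve_left hb') h)
  refine ⟨π', fun a ha => ?_, fun a ha hak h => ?_⟩
  · simp only [NPerm.onNom, hπ' a.1 a.2 (.inl ha), Sigma.eta, ha, if_true]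
  · simp only [NPerm.onNom, hπ' a.1 a.2 (.inr ha), Sigma.eta, hak, if_false] at h
    exact hg₁ a.1 a.2 ha (.inl h)

/-! ## Permuting and substituting -/

/-- `(π.t)[θ]`. -/
noncomputable def Term.val {L : Lang} {τ : L.Ty} (θ : ∀ τ : L.Ty, EVar τ → Term L τ) (π : NPerm L)
    (t : Term L τ) : Term L τ :=
  t.sb θ fun τ a => .nom (π.toEquiv τ a)

theorem NPerm.act_eq_val {L : Lang} {τ : L.Ty} (π : NPerm L) (t : Term L τ) :
    π.act t = t.val (fun _ x => .var x) π := by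
  obtain ⟨r, rfl⟩ := t.exists_mk
  exact (Term.sb_mk r ⟨fun _ v => .bvar v, fun _ x => .fvar x, fun τ a => .nom (π.toEquiv τ a)⟩
    (fun _ _ => rfl) fun _ _ => rfl).symm

theorem Subst.apply_act {L : Lang} {τ : L.Ty} (θ : Subst L) (π : NPerm L) (t : Term L τ) :
    θ.apply (π.act t) = t.val θ.toFun π := by
  have : ∀ t : Term L τ, θ.apply t = t.sb θ.toFun fun _ a => .nom a := by
    intro t
    obtain ⟨r, rfl⟩ := t.exists_mk
    refine (Term.sb_mk r ⟨fun _ v => .bvar v, fun τ x =>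
      Quotient.out (s := convSetoid L [] τ) (θ.toFun τ x), fun _ a => .nom a⟩
      (fun _ _ => Term.mk_out _) fun _ _ => rfl).symm
  rw [this, NPerm.act_eq_val, Term.val, Term.sb_sb]
  exact Term.sb_congr t (fun x _ => Term.sb_var _ _ _) fun a _ => Term.sb_nom _ _ _

theorem Term.val_congr {L : Lang} {τ : L.Ty} {θ θ' : ∀ τ : L.Ty, EVar τ → Term L τ}
    {π π' : NPerm L} (t : Term L τ) (h : ∀ x ∈ t.fvars, θ x.1 x.2 = θ' x.1 x.2)
    (hπ : ∀ a ∈ t.supp, π.onNom a = π'.onNom a) : t.val θ π = t.val θ' π' :=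
  Term.sb_congr t h fun a ha => by rw [NPerm.toEquiv_eq (hπ a ha)]

/-- The outer permutation also acts on the terms brought in by the inner substitution, so the
composite substitution depends on π. -/
theorem Term.val_val {L : Lang} {τ : L.Ty} (θ θ' : ∀ τ : L.Ty, EVar τ → Term L τ)
    (π π' : NPerm L) (t : Term L τ) :
    (t.val θ' π').val θ π = t.val (fun τ x => (θ' τ x).val θ π) (π.comp π') := by
  rw [Term.val, Term.val, Term.sb_sb]
  exact Term.sb_congr t (fun x _ => rfl) fun a _ => Term.sb_nom _ _ _

theorem Term.val_refl {L : Lang} {τ : L.Ty} (t : Term L τ) :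
    t.val (fun _ x => .var x) (.refl L) = t := t.sb_id

theorem Term.val_closed {L : Lang} {τ : L.Ty} {θ : ∀ τ : L.Ty, EVar τ → Term L τ}
    {π : NPerm L} {t : Term L τ} (h : t.fvars = ∅) (h' : t.supp = ∅) : t.val θ π = t :=
  (Term.val_congr t (by simp [h]) (by simp [h'])).trans t.val_refl

theorem Term.val_app {L : Lang} {σ τ : L.Ty} (θ : ∀ τ : L.Ty, EVar τ → Term L τ) (π : NPerm L)
    (t : Term L (.arr σ τ)) (u : Term L σ) : (t.app u).val θ π = (t.val θ π).app (u.val θ π) :=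
  Term.sb_app _ _ _ _

theorem Term.val_apps {L : Lang} {τ : L.Ty} (θ : ∀ τ : L.Ty, EVar τ → Term L τ) (π : NPerm L)
    {ts : List L.Ty} (t : Term L (arrows ts τ)) (us : HL (Term L) ts) :
    (t.apps us).val θ π = (t.val θ π).apps (us.map fun _ u => u.val θ π) :=
  Term.sb_apps _ _ _ _

theorem Term.val_const {L : Lang} {τ : L.Ty} (θ : ∀ τ : L.Ty, EVar τ → Term L τ) (π : NPerm L)
    (c : Const L τ) : (Term.const c).val θ π = .const c := rfl

theorem Term.val_var {L : Lang} {τ : L.Ty} (θ : ∀ τ : L.Ty, EVar τ → Term L τ) (π : NPerm L)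
    (x : EVar τ) : (Term.var x).val θ π = θ τ x := Term.sb_var _ _ _

theorem Term.val_nom {L : Lang} {τ : L.Ty} (θ : ∀ τ : L.Ty, EVar τ → Term L τ) (π : NPerm L)
    (a : L.Nom τ) : (Term.nom a).val θ π = .nom (π.toEquiv τ a) := Term.sb_nom _ _ _

theorem Term.fvars_val_subset {L : Lang} {τ : L.Ty} {θ : ∀ τ : L.Ty, EVar τ → Term L τ}
    {π : NPerm L} (t : Term L τ) {A : Set L.Var} (h : ∀ x ∈ t.fvars, (θ x.1 x.2).fvars ⊆ A) :
    (t.val θ π).fvars ⊆ A :=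
  t.fvars_sb_subset h fun a _ => by simp [Term.fvars_nom]

theorem Term.supp_val_subset {L : Lang} {τ : L.Ty} {θ : ∀ τ : L.Ty, EVar τ → Term L τ}
    {π : NPerm L} (t : Term L τ) {A : Set L.Nominal} (h : ∀ x ∈ t.fvars, (θ x.1 x.2).supp ⊆ A)
    (h' : ∀ a ∈ t.supp, π.onNom a ∈ A) : (t.val θ π).supp ⊆ A :=
  t.supp_sb_subset h fun a ha =>
    (Term.supp_nom_subset _).trans (Set.singleton_subset_iff.2 (h' a ha))

/-- The hypothesis excludes capture: the renamed c must not occur in the terms that replace the free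
variables of t. -/
theorem Term.val_absNom {L : Lang} {σ τ : L.Ty} {θ : ∀ τ : L.Ty, EVar τ → Term L τ} {π : NPerm L}
    (c : L.Nom σ) (t : Term L τ)
    (h : ∀ x ∈ t.fvars, (⟨σ, π.toEquiv σ c⟩ : L.Nominal) ∉ (θ x.1 x.2).supp) :
    (t.absNom c).val θ π = (t.val θ π).absNom (π.toEquiv σ c) := by
  obtain ⟨r, rfl, h₁, -⟩ := t.exists_exact
  choose e he using fun τ : L.Ty => fun t : Term L τ => t.exists_exact
  let E : Env L [] [] :=
    ⟨fun _ v => .bvar v, fun τ x => e τ (θ τ x), fun τ a => .nom (π.toEquiv τ a)⟩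
  have h₂ : ∀ {τ : L.Ty} (r : Raw L [] τ), (Term.mk r).val θ π = .mk (r.bind E) := fun r =>
    Term.sb_mk r E (fun x _ => (he _ _).1) fun a _ => rfl
  rw [h₂ r]
  refine (h₂ (r.absNom c)).trans (Term.mk_eq_mk.2 (.lam ?_))
  change Conv ((r.bind (Env.absNom c)).bind (E.lift σ)) ((r.bind E).bind (Env.absNom _))
  rw [Raw.bind_bind, Raw.bind_bind]
  refine Raw.conv_bind r _ _ (fun τ v => nomatch v) (fun x hx => ?_) fun a _ => ?_
  · change Conv ((e _ (θ x.1 x.2)).ren (Ren.shift σ)) ((e _ (θ x.1 x.2)).bind (Env.absNom _))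
    rw [Raw.ren_eq_bind]
    refine Raw.conv_bind _ _ _ (fun τ v => .refl _) (fun x _ => .refl _) fun a ha => ?_
    rw [Env.absNom_of_ne]
    · exact .refl _
    · rintro rfl
      exact h x (h₁ ▸ hx) ((he _ _).2.2 ▸ ha)
  · change Conv (((Env.absNom c).nm a.1 a.2).bind (E.lift σ))
      ((Env.absNom (π.toEquiv σ c)).nm a.1 (π.toEquiv a.1 a.2))
    by_cases hac : a = ⟨σ, c⟩
    · subst hac
      rw [Env.absNom_self, Env.absNom_self]
      exact .refl _
    · have : (⟨a.1, π.toEquiv a.1 a.2⟩ : L.Nominal) ≠ ⟨σ, π.toEquiv σ c⟩ := fun h =>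
        hac (π.onNom_injective h)
      rw [Env.absNom_of_ne c hac, Env.absNom_of_ne _ this]
      exact .refl _

/-! ### Heterogeneous lists -/

theorem HL.toList_map {β : Type} {F G : SType β → Type} (f : ∀ τ, F τ → G τ) {ts : List (SType β)}
    (as : HL F ts) : (as.map f).toList = as.toList.map fun p => ⟨p.1, f p.1 p.2⟩ := by
  induction as with
  | nil => rfl
  | cons a as ih => simp only [HL.map, HL.toList, List.map_cons, ih]

theorem HL.map_map {β : Type} {F G H : SType β → Type} (f : ∀ τ, F τ → G τ) (g : ∀ τ, G τ → H τ)
    {ts : List (SType β)} (as : HL F ts) :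
    (as.map f).map g = as.map fun τ a => g τ (f τ a) := by
  induction as with
  | nil => rfl
  | cons a as ih => simp only [HL.map, ih]

/-- A list of typed entries as a heterogeneous list. -/
def HL.ofList {β : Type} {F : SType β → Type} :
    (l : List (Σ τ, F τ)) → HL F (l.map Sigma.fst)
  | [] => .nil
  | p :: l => .cons p.2 (HL.ofList l)

theorem HL.toList_ofList {β : Type} {F : SType β → Type} (l : List (Σ τ, F τ)) :
    (HL.ofList l).toList = l := by
  induction l with
  | nil => rfl
  | cons p l ih => simp only [HL.ofList, HL.toList, ih]

theorem Term.val_absNoms {L : Lang} {τ : L.Ty} {θ : ∀ τ : L.Ty, EVar τ → Term L τ} {π : NPerm L}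
    {ts : List L.Ty} (cs : HL L.Nom ts) (t : Term L τ)
    (h : ∀ c ∈ cs.toList, ∀ x ∈ t.fvars, π.onNom c ∉ (θ x.1 x.2).supp) :
    (t.absNoms cs).val θ π = (t.val θ π).absNoms (cs.map fun τ a => π.toEquiv τ a) := by
  induction cs with
  | nil => rfl
  | cons c cs ih =>
    simp only [HL.toList, List.mem_cons, forall_eq_or_imp] at h
    have := Term.val_absNom (θ := θ) (π := π) c (t.absNoms cs) fun x hx =>
      h.1 x (Term.fvars_absNoms_subset cs t hx)
    rw [ih h.2] at this
    exact this

/-- The abstracted constants need not belong to the supports of s and t, so π may carry them into F,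
where abstraction would capture constants of θ. Changing π outside these supports leaves both values
alone and moves such constants outside F. -/
theorem NaHolds.val {L : Lang} {ts : List L.Ty} {τ : L.Ty} {s : Term L (arrows ts τ)}
    {t : Term L τ} (h : NaHolds s t) {θ : ∀ τ : L.Ty, EVar τ → Term L τ} {π : NPerm L}
    {F : Set L.Nominal} (hF : F.Finite) (hθ : ∀ x ∈ t.fvars, (θ x.1 x.2).supp ⊆ F)
    (hπ : ∀ a ∈ s.supp ∪ t.supp, π.onNom a ∉ F) : NaHolds (s.val θ π) (t.val θ π) := by
  rw [naHolds_iff] at h ⊢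
  obtain ⟨cs, hcs, hs⟩ := h
  obtain ⟨π', h₁, h₂⟩ := π.exists_fresh (s.finite_supp.union t.finite_supp)
    cs.toList.finite_toSet hF
  refine ⟨cs.map fun τ a => π'.toEquiv τ a, ?_, ?_⟩
  · rw [HL.toList_map]
    exact hcs.map π'.onNom_injective
  · rw [Term.val_congr (π' := π') s (fun _ _ => rfl) fun a ha => (h₁ a (.inl ha)).symm,
      Term.val_congr (π' := π') t (fun _ _ => rfl) fun a ha => (h₁ a (.inr ha)).symm, hs]
    refine Term.val_absNoms cs t fun c hc x hx hcx => ?_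
    by_cases h : c ∈ s.supp ∪ t.supp
    · exact hπ c h (h₁ c h ▸ hθ x hx hcx)
    · exact h₂ c hc h (hθ x hx hcx)

/-! ## Values of nominal capture avoiding application -/

/-- `B'` is `(π.B)[θ]` for a permutation `π` that maps the support of `B` outside `F`. -/
def IsVal {L : Lang} {τ : L.Ty} (F : Set L.Nominal) (θ : ∀ τ : L.Ty, EVar τ → Term L τ)
    (B B' : Term L τ) : Prop :=
  ∃ π : NPerm L, (∀ a ∈ B.supp, π.onNom a ∉ F) ∧ B' = B.val θ π

theorem Subst.ncas_iff {L : Lang} {τ : L.Ty} {θ : Subst L} {B B' : Term L τ} :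
    θ.NCAS B B' ↔ IsVal θ.supp θ.toFun B B' := by
  simp only [Subst.NCAS, IsVal, Subst.apply_act]

theorem Subst.ncas_eq {L : Lang} {τ : L.Ty} (θ : Subst L) :
    θ.NCAS = IsVal (τ := τ) θ.supp θ.toFun := by
  funext B B'
  exact propext Subst.ncas_iff

theorem Subst.solves_iff {L : Lang} {θ : Subst L} {ts : List L.Ty} {τ : L.Ty}
    {s : Term L (arrows ts τ)} {t : Term L τ} :
    θ.Solves s t ↔ ∃ π : NPerm L, (∀ a ∈ s.supp ∪ t.supp, π.onNom a ∉ θ.supp) ∧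
      NaHolds (s.val θ.toFun π) (t.val θ.toFun π) := by
  simp only [Subst.Solves, Subst.apply_act]

theorem permEq_iff {L : Lang} {τ : L.Ty} {B B' : Term L τ} :
    PermEq B B' ↔ IsVal ∅ (fun _ x => .var x) B' B := by
  simp only [PermEq, IsVal, NPerm.act_eq_val, Set.mem_empty_iff_false, not_false_iff, implies_true,
    true_and]

theorem IsVal.exists {L : Lang} {τ : L.Ty} {F : Set L.Nominal} (hF : F.Finite)
    (θ : ∀ τ : L.Ty, EVar τ → Term L τ) (B : Term L τ) : ∃ B', IsVal F θ B B' := by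
  obtain ⟨π, -, h⟩ := (NPerm.refl L).exists_fresh Set.finite_empty B.finite_supp hF
  exact ⟨_, π, fun a ha => h a ha (Set.notMem_empty a), rfl⟩

/-- Any two values are the same up to a permutation. -/
theorem IsVal.permEq {L : Lang} {τ : L.Ty} {F : Set L.Nominal} (hF : F.Finite)
    {θ : ∀ τ : L.Ty, EVar τ → Term L τ} {B B₁ B₂ : Term L τ}
    (hθ : ∀ x ∈ B.fvars, (θ x.1 x.2).supp ⊆ F) (h₁ : IsVal F θ B B₁) (h₂ : IsVal F θ B B₂) :
    PermEq B₂ B₁ := by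
  classical
  obtain ⟨π₁, h₁, rfl⟩ := h₁
  obtain ⟨π₂, h₂, rfl⟩ := h₂
  -- σ fixes F pointwise, hence every term θ(x), and sends π₁(a) to π₂(a) for a in supp(B). The two
  -- requirements are compatible because π₁ and π₂ carry supp(B) outside F.
  obtain ⟨σ, hσ⟩ := NPerm.exists_extend (hF.union (B.finite_supp.image π₁.onNom))
    (fun τ a => if (⟨τ, a⟩ : L.Nominal) ∈ F then a else π₂.toEquiv τ ((π₁.toEquiv τ).symm a)) (by
      have mixed : ∀ τ a b, (⟨τ, a⟩ : L.Nominal) ∈ F → (⟨τ, b⟩ : L.Nominal) ∈ π₁.onNom '' B.supp →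
          a ≠ π₂.toEquiv τ ((π₁.toEquiv τ).symm b) := by
        rintro τ a b ha ⟨⟨υ, c⟩, hc, hcb⟩ h
        cases hcb
        rw [Equiv.symm_apply_apply] at h
        subst h
        exact h₂ _ hc ha
      intro τ a b ha hb h
      by_cases ha' : (⟨τ, a⟩ : L.Nominal) ∈ F <;> by_cases hb' : (⟨τ, b⟩ : L.Nominal) ∈ F <;>
        simp only [ha', hb', if_true, if_false] at h
      · exact h
      · exact absurd h (mixed τ a b ha' (hb.resolve_left hb'))
      · exact absurd h.symm (mixed τ b a hb' (ha.resolve_left ha'))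
      · exact (π₁.toEquiv τ).symm.injective ((π₂.toEquiv τ).injective h))
  refine ⟨σ, ?_⟩
  rw [NPerm.act_eq_val, Term.val_val]
  refine Term.val_congr B (fun x hx => ?_) fun a ha => ?_
  · refine ((Term.val_congr _ (fun _ _ => rfl) fun a ha => ?_).trans (Term.val_refl _)).symm
    have ha := hθ x hx ha
    simp only [NPerm.onNom, hσ a.1 a.2 (.inl ha), Sigma.eta, ha, if_true]
    rfl
  · have : σ.toEquiv a.1 (π₁.toEquiv a.1 a.2) = π₂.toEquiv a.1 a.2 := by
      refine (hσ _ _ (.inr ⟨a, ha, rfl⟩)).trans ((if_neg (h₁ a ha)).trans ?_)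
      rw [Equiv.symm_apply_apply]
    simp only [NPerm.onNom, NPerm.comp, Equiv.trans_apply, this]

theorem PermEq.trans {L : Lang} {τ : L.Ty} {A B C : Term L τ} (h₁ : PermEq A B)
    (h₂ : PermEq B C) : PermEq A C := by
  obtain ⟨π, rfl⟩ := h₁
  obtain ⟨π', rfl⟩ := h₂
  refine ⟨π.comp π', ?_⟩
  simp only [NPerm.act_eq_val, Term.val_val, Term.val_var]

/-- A value of ρ.B' by π is a value of B' by π ∘ ρ. -/
theorem IsVal.of_permEq {L : Lang} {τ : L.Ty} {F : Set L.Nominal}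
    {θ : ∀ τ : L.Ty, EVar τ → Term L τ} {B B' X : Term L τ} (h : PermEq B B') (hX : IsVal F θ B X) :
    IsVal F θ B' X := by
  obtain ⟨ρ, rfl⟩ := h
  obtain ⟨π, hπ, rfl⟩ := hX
  rw [NPerm.act_eq_val] at hπ ⊢
  refine ⟨π.comp ρ, fun a ha => hπ (ρ.onNom a) ?_, ?_⟩
  · let ρ' : NPerm L :=
      { toEquiv := fun τ => (ρ.toEquiv τ).symm
        finite_moved := ρ.finite_moved.subset fun a h h' => h (by
          conv_lhs => rw [← h']
          exact Equiv.symm_apply_apply _ _) }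
    have : B' = (B'.val (fun _ x => .var x) ρ).val (fun _ x => .var x) ρ' := by
      rw [Term.val_val]
      simp only [Term.val_var]
      refine B'.val_refl.symm.trans (Term.val_congr _ (fun _ _ => rfl) fun a _ => ?_)
      simp [NPerm.onNom, NPerm.refl, NPerm.comp, ρ']
    rw [this] at ha
    have key := Term.supp_val_subset (θ := fun _ x => .var x) (π := ρ')
      (B'.val (fun _ x => .var x) ρ)
      (A := {a | ρ.onNom a ∈ (B'.val (fun _ x => .var x) ρ).supp})
      (fun x _ => by simp [Term.supp_var]) (fun a ha => by simpa [NPerm.onNom, ρ'] using ha)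
    exact key ha
  · rw [Term.val_val]
    simp only [Term.val_var]

/-! ### Values of compound formulas -/

theorem supp_const_app {L : Lang} {σ τ : L.Ty} (c : Const L (.arr σ τ)) (A : Term L σ) :
    ((Term.const c).app A).supp = A.supp := by
  rw [(Term.constHeaded_const c).supp_app, Term.supp_const, Set.empty_union]

theorem fvars_const_app {L : Lang} {σ τ : L.Ty} (c : Const L (.arr σ τ)) (A : Term L σ) :
    ((Term.const c).app A).fvars = A.fvars := by
  rw [(Term.constHeaded_const c).fvars_app, Term.fvars_const, Set.empty_union]

theorem supp_const_app₂ {L : Lang} {ρ σ τ : L.Ty} (c : Const L (.arr ρ (.arr σ τ)))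
    (A : Term L ρ) (B : Term L σ) :
    (((Term.const c).app A).app B).supp = A.supp ∪ B.supp := by
  rw [((Term.constHeaded_const c).app A).supp_app, supp_const_app]

theorem fvars_const_app₂ {L : Lang} {ρ σ τ : L.Ty} (c : Const L (.arr ρ (.arr σ τ)))
    (A : Term L ρ) (B : Term L σ) :
    (((Term.const c).app A).app B).fvars = A.fvars ∪ B.fvars := by
  rw [((Term.constHeaded_const c).app A).fvars_app, fvars_const_app]

theorem IsVal.of_const_app₂ {L : Lang} {ρ σ τ : L.Ty} {F : Set L.Nominal}
    {θ : ∀ τ : L.Ty, EVar τ → Term L τ} {c : Const L (.arr ρ (.arr σ τ))} {A : Term L ρ}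
    {B : Term L σ} {X : Term L τ} (h : IsVal F θ (((Term.const c).app A).app B) X) :
    ∃ A' B', X = ((Term.const c).app A').app B' ∧ IsVal F θ A A' ∧ IsVal F θ B B' := by
  obtain ⟨π, hπ, rfl⟩ := h
  rw [supp_const_app₂] at hπ
  exact ⟨A.val θ π, B.val θ π, by simp only [Term.val_app, Term.val_const],
    ⟨π, fun a ha => hπ a (.inl ha), rfl⟩, ⟨π, fun a ha => hπ a (.inr ha), rfl⟩⟩

theorem IsVal.of_const_app {L : Lang} {σ τ : L.Ty} {F : Set L.Nominal}
    {θ : ∀ τ : L.Ty, EVar τ → Term L τ} {c : Const L (.arr σ τ)} {A : Term L σ}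
    {X : Term L τ} (h : IsVal F θ ((Term.const c).app A) X) :
    ∃ π : NPerm L, (∀ a ∈ A.supp, π.onNom a ∉ F) ∧ X = (Term.const c).app (A.val θ π) := by
  obtain ⟨π, hπ, rfl⟩ := h
  rw [supp_const_app] at hπ
  exact ⟨π, hπ, by simp only [Term.val_app, Term.val_const]⟩

theorem IsVal.of_fNa {L : Lang} {F : Set L.Nominal} {θ : ∀ τ : L.Ty, EVar τ → Term L τ}
    {ts : List L.Ty} {τ : L.Ty} {h : L.NaTy ts τ} {s : Term L (arrows ts τ)} {t : Term L τ}
    {X : Fm L} (hX : IsVal F θ (fNa h s t) X) :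
    ∃ π : NPerm L, (∀ a ∈ s.supp ∪ t.supp, π.onNom a ∉ F) ∧
      X = fNa h (s.val θ π) (t.val θ π) := by
  obtain ⟨π, hπ, rfl⟩ := hX
  rw [fNa, supp_const_app₂] at hπ
  exact ⟨π, hπ, by simp only [fNa, Term.val_app, Term.val_const]⟩

/-- The constants of V t⃗, for closed V, already occur in p t⃗, so the same permutation serves. V is
the body of a clause applied to p, or a (co-)invariant. -/
theorem IsVal.of_fAtom {L : Lang} {F : Set L.Nominal} {θ : ∀ τ : L.Ty, EVar τ → Term L τ}
    {ts : List L.Ty} {p : L.Pr ts} {us : HL (Term L) ts} {X : Fm L}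
    (h : IsVal F θ (fAtom p us) X) :
    ∃ us' : HL (Term L) ts, X = fAtom p us' ∧ ∀ V : Term L (arrows ts .o), V.fvars = ∅ →
      V.supp = ∅ → IsVal F θ (V.apps us) (V.apps us') := by
  obtain ⟨π, hπ, rfl⟩ := h
  refine ⟨us.map fun _ u => u.val θ π, by rw [fAtom, Term.val_apps, Term.val_const, fAtom],
    fun V hV hV' => ⟨π, fun a ha => hπ a ?_, by rw [Term.val_apps, Term.val_closed hV hV']⟩⟩
  exact Term.supp_apps_subset V us (by simp [hV'])
    ((Term.constHeaded_const (.pr p)).subset_supp_apps us).2 ha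

theorem Clause.fvars_body_app {L : Lang} {ts : List L.Ty} (cl : Clause L ts) (p : L.Pr ts) :
    (cl.body.app (.const (.pr p))).fvars = ∅ :=
  Set.subset_empty_iff.1 ((Term.fvars_app_subset _ _).trans (by
    simp [cl.body_closed, Term.fvars_const]))

theorem Clause.supp_body_app {L : Lang} {ts : List L.Ty} (cl : Clause L ts) (p : L.Pr ts) :
    (cl.body.app (.const (.pr p))).supp = ∅ :=
  Set.subset_empty_iff.1 ((Term.supp_app_subset _ _).trans (by
    simp [cl.body_supp, Term.supp_const]))

theorem IsVal.congr {L : Lang} {τ : L.Ty} {F : Set L.Nominal}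
    {θ θ' : ∀ τ : L.Ty, EVar τ → Term L τ} {B X : Term L τ} (h : IsVal F θ B X)
    (hθ : ∀ x ∈ B.fvars, θ x.1 x.2 = θ' x.1 x.2) : IsVal F θ' B X := by
  obtain ⟨π, hπ, rfl⟩ := h
  exact ⟨π, hπ, Term.val_congr B hθ fun _ _ => rfl⟩

/-! ## Substitutions and signatures -/

theorem Subst.supp_subset {L : Lang} (θ : Subst L) (x : L.Var) :
    (θ.toFun x.1 x.2).supp ⊆ θ.supp := by
  intro a ha
  by_cases h : x ∈ θ.dom
  · exact ⟨x, h, ha⟩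
  · rw [not_not.1 h, Term.supp_var] at ha
    exact absurd ha (Set.notMem_empty a)

theorem Subst.finite_supp {L : Lang} (θ : Subst L) : θ.supp.Finite := by
  refine (θ.finite_dom.biUnion fun x _ => (θ.toFun x.1 x.2).finite_supp).subset ?_
  rintro a ⟨x, hx, ha⟩
  exact Set.mem_biUnion (t := fun x : L.Var => (θ.toFun x.1 x.2).supp) hx ha

theorem Subst.finite_applySig {L : Lang} (θ : Subst L) {S : Set L.Var} (hS : S.Finite) :
    (θ.applySig S).Finite := by
  refine hS.sdiff.union
    ((θ.finite_dom.biUnion fun x _ => (θ.toFun x.1 x.2).finite_fvars).subset ?_)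
  rintro a ⟨x, hx, ha⟩
  exact Set.mem_biUnion (t := fun x : L.Var => (θ.toFun x.1 x.2).fvars) hx ha

theorem Subst.fvars_subset_applySig {L : Lang} (θ : Subst L) {S : Set L.Var} {x : L.Var}
    (hx : x ∈ S) : (θ.toFun x.1 x.2).fvars ⊆ θ.applySig S := by
  intro y hy
  by_cases h : x ∈ θ.dom
  · exact .inr ⟨x, h, hy⟩
  · rw [not_not.1 h, Term.fvars_var] at hy
    cases hy
    exact .inl ⟨hx, h⟩

/-- Σθ includes the free variables of θ(x) for all x in the domain, also for x outside Σ; the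
condition on the domain controls these. -/
theorem Subst.applySig_subset {L : Lang} (θ : Subst L) {S A : Set L.Var} (hd : θ.dom ⊆ S)
    (h : ∀ x ∈ S, (θ.toFun x.1 x.2).fvars ⊆ A) : θ.applySig S ⊆ A := by
  rintro y (⟨hy, hyd⟩ | ⟨x, hx, hy⟩)
  · refine h y hy ?_
    rw [not_not.1 hyd, Term.fvars_var]
    rfl
  · exact h x (hd hx) hy

/-- `θ` maps the variables of `S` to terms with free variables in the finite set `S'` and with
nominal constants in the finite set `F`. -/
structure MapsSig {L : Lang} (S : Set L.Var) (θ : ∀ τ : L.Ty, EVar τ → Term L τ)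
    (F : Set L.Nominal) (S' : Set L.Var) : Prop where
  finite_supp : F.Finite
  finite_sig : S'.Finite
  supp_subset : ∀ x ∈ S, (θ x.1 x.2).supp ⊆ F
  fvars_subset : ∀ x ∈ S, (θ x.1 x.2).fvars ⊆ S'

theorem Subst.mapsSig {L : Lang} (θ : Subst L) {S : Set L.Var} (hS : S.Finite) :
    MapsSig S θ.toFun θ.supp (θ.applySig S) :=
  ⟨θ.finite_supp, θ.finite_applySig hS, fun x _ => θ.supp_subset x,
    fun _ hx => θ.fvars_subset_applySig hx⟩

theorem IsVal.fvars_subset {L : Lang} {τ : L.Ty} {S S' : Set L.Var}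
    {θ : ∀ τ : L.Ty, EVar τ → Term L τ} {F : Set L.Nominal} {B B' : Term L τ}
    (h : IsVal F θ B B') (hθ : MapsSig S θ F S') (hB : B.fvars ⊆ S) : B'.fvars ⊆ S' := by
  obtain ⟨π, -, rfl⟩ := h
  exact B.fvars_val_subset fun x hx => hθ.fvars_subset x (hB hx)

theorem rel_exists_left {α β : Type*} {r : α → β → Prop} {s : Multiset α} {t : Multiset β}
    (h : Multiset.Rel r s t) {b : β} (hb : b ∈ t) : ∃ a ∈ s, r a b :=
  Multiset.exists_mem_of_rel_of_mem (Multiset.rel_flip.2 h) hb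

/-- The composite may be verified just at intermediate elements that are present in t, where
well-formedness bounds the free variables. -/
theorem rel_comp {α β γ : Type*} {r : α → β → Prop} {p : β → γ → Prop}
    {q : α → γ → Prop} {s : Multiset α} {t : Multiset β} {u : Multiset γ}
    (h₁ : Multiset.Rel r s t) (h₂ : Multiset.Rel p t u)
    (h : ∀ a, ∀ b ∈ t, ∀ c, r a b → p b c → q a c) : Multiset.Rel q s u := by
  induction h₁ generalizing u with
  | zero =>
    rw [Multiset.rel_zero_left] at h₂
    exact h₂ ▸ .zero
  | cons hab _ ih =>
    obtain ⟨c, u', hc, hu, rfl⟩ := Multiset.rel_cons_left.1 h₂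
    exact .cons (h _ _ (Multiset.mem_cons_self _ _) _ hab hc)
      (ih hu fun a b hb => h a b (Multiset.mem_cons_of_mem hb))

theorem rel_exists_right {α β : Type*} {r : α → β → Prop} (h : ∀ a, ∃ b, r a b)
    (s : Multiset α) : ∃ t, Multiset.Rel r s t := by
  induction s using Multiset.induction_on with
  | empty => exact ⟨0, .zero⟩
  | cons a s ih =>
    obtain ⟨t, ht⟩ := ih
    obtain ⟨b, hb⟩ := h a
    exact ⟨b ::ₘ t, .cons hb ht⟩

theorem Sequent.WF.map {L : Lang} {q : Sequent L} (hq : q.WF) {S' : Set L.Var}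
    {θ : ∀ τ : L.Ty, EVar τ → Term L τ} {F : Set L.Nominal} (hθ : MapsSig q.sig θ F S')
    {Γ' : Multiset (Fm L)} {C' : Fm L} (hΓ : Multiset.Rel (IsVal F θ) q.hyps Γ')
    (hC : IsVal F θ q.concl C') : Sequent.WF ⟨S', Γ', C'⟩ where
  sig_finite := hθ.finite_sig
  hyps_fvars := by
    intro B' hB'
    obtain ⟨B, hB, h⟩ := rel_exists_left hΓ hB'
    exact h.fvars_subset hθ (hq.hyps_fvars B hB)
  concl_fvars := hC.fvars_subset hθ hq.concl_fvars

/-! ## Instances of quantified formulas -/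

/-- π is constrained only on supp(B); altering it elsewhere moves the remaining constants of t
outside F. The instance is (π'.t)[θ] for the altered π', which does not change the value of B. -/
theorem exists_instance {L : Lang} {S S' : Set L.Var} {θ : ∀ τ : L.Ty, EVar τ → Term L τ}
    {F : Set L.Nominal} (hθ : MapsSig S θ F S') {σ τ : L.Ty} {B : Term L (.arr σ τ)} {π : NPerm L}
    (hπ : ∀ a ∈ B.supp, π.onNom a ∉ F) {t : Term L σ} (ht : t.fvars ⊆ S) :
    ∃ t' : Term L σ, t'.fvars ⊆ S' ∧ IsVal F θ (B.app t) ((B.val θ π).app t') := by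
  obtain ⟨π', h₁, h₂⟩ := π.exists_fresh B.finite_supp t.finite_supp hθ.finite_supp
  refine ⟨t.val θ π', t.fvars_val_subset fun x hx => hθ.fvars_subset x (ht hx), π',
    fun a ha => ?_, ?_⟩
  · by_cases h : a ∈ B.supp
    · exact h₁ a h ▸ hπ a h
    · exact h₂ a ((Term.supp_app_subset _ _ ha).resolve_left h) h
  · rw [Term.val_app, Term.val_congr B (fun _ _ => rfl) h₁]

theorem exists_fresh_instance {L : Lang} {θ : ∀ τ : L.Ty, EVar τ → Term L τ}
    {F : Set L.Nominal} (hF : F.Finite) {σ τ : L.Ty} {B : Term L (.arr σ τ)} {π : NPerm L}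
    (hπ : ∀ a ∈ B.supp, π.onNom a ∉ F) {a : L.Nom σ} (ha : (⟨σ, a⟩ : L.Nominal) ∉ B.supp) :
    ∃ a' : L.Nom σ, (⟨σ, a'⟩ : L.Nominal) ∉ (B.val θ π).supp ∧
      IsVal F θ (B.app (.nom a)) ((B.val θ π).app (.nom a')) := by
  -- The image of a must avoid F, for an admissible permutation, and the support of the new body,
  -- for the side condition of ∇.
  obtain ⟨π', h₁, h₂⟩ := π.exists_fresh B.finite_supp (Set.finite_singleton (⟨σ, a⟩ : L.Nominal))
    (hF.union (B.val θ π).finite_supp)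
  have h₂ := h₂ _ rfl ha
  refine ⟨π'.toEquiv σ a, fun h => h₂ (.inr h), π', fun b hb => ?_, ?_⟩
  · by_cases h : b ∈ B.supp
    · exact h₁ b h ▸ hπ b h
    · have := Term.supp_nom_subset a ((Term.supp_app_subset _ _ hb).resolve_left h)
      cases this
      exact fun h => h₂ (.inl h)
  · rw [Term.val_app, Term.val_nom, Term.val_congr B (fun _ _ => rfl) h₁]

/-! ## Raising over the support -/

theorem exists_lists {L : Lang} {τ : L.Ty} (B : Term L τ) :
    ∃ (cs : List L.Ty) (c : HL L.Nom cs), Lists c B := by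
  classical
  refine ⟨_, HL.ofList B.finite_supp.toFinset.toList, ?_, ?_⟩
  · rw [HL.toList_ofList]
    exact Finset.nodup_toList _
  · intro a
    rw [HL.toList_ofList]
    simp

/-- Nominal constants have types without o, so raising over them gives a type that variables may
have. -/
theorem ofree_arrows {L : Lang} {cs : List L.Ty} (c : HL L.Nom cs) {τ : L.Ty} (hτ : τ.OFree) :
    (arrows cs τ).OFree := by
  induction c with
  | nil => exact hτ
  | cons a _ ih => exact ⟨L.nab_ofree _ (Lang.nabTy_of_nom a), ih⟩

theorem exists_fresh_var {L : Lang} {S : Set L.Var} (hS : S.Finite) {τ : L.Ty} (hτ : τ.OFree) :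
    ∃ x : EVar τ, (⟨τ, x⟩ : L.Var) ∉ S := by
  have inj : Function.Injective fun n : ℕ => (⟨τ, ⟨n, hτ⟩⟩ : L.Var) := by
    intro m n h
    simpa using h
  obtain ⟨n, hn⟩ := (hS.preimage inj.injOn).exists_notMem
  exact ⟨⟨n, hτ⟩, hn⟩

theorem exists_update {L : Lang} (θ : ∀ τ : L.Ty, EVar τ → Term L τ) {σ : L.Ty} (h : EVar σ)
    (u : Term L σ) : ∃ θ' : ∀ τ : L.Ty, EVar τ → Term L τ, θ' σ h = u ∧
      ∀ x : L.Var, x ≠ ⟨σ, h⟩ → θ' x.1 x.2 = θ x.1 x.2 := by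
  classical
  refine ⟨fun τ x => Function.update (β := fun v : L.Var => Term L v.1) (fun v => θ v.1 v.2)
    ⟨σ, h⟩ u ⟨τ, x⟩, Function.update_self _ _ _, fun x hx => ?_⟩
  exact Function.update_of_ne hx u fun v : L.Var => θ v.1 v.2

/-- The support of the new body may lose constants of π(supp(B)) and gain constants of F, so h' is
raised over a different list c⃗'. Sending h to λ(π.c⃗). h' c⃗' makes the value of h c⃗ equal to h'
c⃗'. -/
theorem exists_raise {L : Lang} {S S' : Set L.Var} {θ : ∀ τ : L.Ty, EVar τ → Term L τ}
    {F : Set L.Nominal} (hθ : MapsSig S θ F S') {σ τ : L.Ty} (hσ : σ.OFree)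
    {B : Term L (.arr σ τ)} (hB : B.fvars ⊆ S) {cs : List L.Ty} {c : HL L.Nom cs} (hc : Lists c B)
    {h : EVar (arrows cs σ)} (hh : (⟨_, h⟩ : L.Var) ∉ S) {π : NPerm L}
    (hπ : ∀ a ∈ B.supp, π.onNom a ∉ F) :
    ∃ (cs' : List L.Ty) (c' : HL L.Nom cs') (h' : EVar (arrows cs' σ))
      (θ' : ∀ τ : L.Ty, EVar τ → Term L τ),
      Lists c' (B.val θ π) ∧ (⟨_, h'⟩ : L.Var) ∉ S' ∧
      MapsSig (insert ⟨_, h⟩ S) θ' F (insert ⟨_, h'⟩ S') ∧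
      (∀ x ∈ S, θ x.1 x.2 = θ' x.1 x.2) ∧
      IsVal F θ' (B.app ((Term.var h).apps (nomTerms c)))
        ((B.val θ π).app ((Term.var h').apps (nomTerms c'))) := by
  obtain ⟨cs', c', hc'⟩ := exists_lists (B.val θ π)
  obtain ⟨h', hh'⟩ := exists_fresh_var hθ.finite_sig (ofree_arrows c' hσ)
  let v : Term L σ := (Term.var h').apps (nomTerms c')
  let u : Term L (arrows cs σ) := v.absNoms (c.map fun τ a => π.toEquiv τ a)
  have mem_nomTerms : ∀ {cs : List L.Ty} (c : HL L.Nom cs), ∀ p ∈ (nomTerms c).toList,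
      ∃ a ∈ c.toList, p = ⟨a.1, .nom a.2⟩ := by
    intro cs c p hp
    simp only [nomTerms, HL.toList_map, List.mem_map] at hp
    obtain ⟨a, ha, rfl⟩ := hp
    exact ⟨a, ha, rfl⟩
  have hu : u.fvars ⊆ {⟨_, h'⟩} := by
    refine (Term.fvars_absNoms_subset _ _).trans (Term.fvars_apps_subset _ _ ?_ fun p hp => ?_)
    · rw [Term.fvars_var]
    · obtain ⟨a, -, rfl⟩ := mem_nomTerms c' p hp
      simp [Term.fvars_nom]
  -- The constants c⃗' lie in F or in π(supp(B)), and the abstraction over π.c⃗ removes the latter.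
  -- Hence the extended substitution keeps the same bound F.
  have hu' : u.supp ⊆ F := by
    have hv : v.supp ⊆ (B.val θ π).supp := by
      refine Term.supp_apps_subset _ _ (by simp [Term.supp_var]) fun p hp => ?_
      obtain ⟨a, ha, rfl⟩ := mem_nomTerms c' p hp
      exact (Term.supp_nom_subset _).trans (Set.singleton_subset_iff.2 ((hc'.2 a).1 ha))
    intro a ha
    obtain ⟨h₁, h₂⟩ := Term.supp_absNoms_subset _ _ ha
    have := Term.supp_val_subset (A := F ∪ π.onNom '' B.supp) B
      (fun x hx => (hθ.supp_subset x (hB hx)).trans Set.subset_union_left)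
      (fun b hb => .inr ⟨b, hb, rfl⟩) (hv h₁)
    rcases this with h | ⟨b, hb, rfl⟩
    · exact h
    · refine absurd ?_ h₂
      rw [HL.toList_map]
      exact List.mem_map.2 ⟨b, (hc.2 b).2 hb, rfl⟩
  obtain ⟨θ', h₁, h₂⟩ := exists_update θ h u
  have agree : ∀ x ∈ S, θ x.1 x.2 = θ' x.1 x.2 := fun x hx =>
    (h₂ x fun he => hh (he ▸ hx)).symm
  refine ⟨cs', c', h', θ', hc', hh', ⟨hθ.finite_supp, hθ.finite_sig.insert _, ?_, ?_⟩, agree,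
    π, fun a ha => hπ a ?_, ?_⟩
  · rintro x (rfl | hx)
    · exact h₁ ▸ hu'
    · exact agree x hx ▸ hθ.supp_subset x hx
  · rintro x (rfl | hx)
    · exact h₁ ▸ hu.trans (Set.singleton_subset_iff.2 (Set.mem_insert _ _))
    · exact agree x hx ▸ (hθ.fvars_subset x hx).trans (Set.subset_insert _ _)
  · refine ((Term.supp_app_subset _ _).trans (Set.union_subset subset_rfl ?_)) ha
    refine Term.supp_apps_subset _ _ (by simp [Term.supp_var]) fun p hp => ?_
    obtain ⟨a, ha, rfl⟩ := mem_nomTerms c p hp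
    exact (Term.supp_nom_subset _).trans (Set.singleton_subset_iff.2 ((hc.2 a).1 ha))
  · rw [Term.val_app, Term.val_congr (θ' := θ') (π' := π) B (fun x hx => agree x (hB hx))
      fun _ _ => rfl, Term.val_apps, Term.val_var, h₁]
    have : ((nomTerms c).map fun _ t => t.val θ' π) =
        nomTerms (c.map fun τ a => π.toEquiv τ a) := by
      simp only [nomTerms, HL.map_map, Term.val_nom]
    rw [this, Term.absNoms_apps]

/-! ## Solutions of instances of nominal abstractions -/

/-- The solution ρ' maps x in S to (κ.θ(x))[ρ], where κ separates the constants of θ from those of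
ρ. Cutting it off outside S keeps its domain finite and its signature within that of ρ. -/
theorem Subst.Solves.exists_of_val {L : Lang} {S S' : Set L.Var} (hS : S.Finite)
    {θ : ∀ τ : L.Ty, EVar τ → Term L τ} {F : Set L.Nominal} (hθ : MapsSig S θ F S')
    {ts : List L.Ty} {τ : L.Ty} {s : Term L (arrows ts τ)} {t : Term L τ} (hs : s.fvars ⊆ S)
    (ht : t.fvars ⊆ S) {π : NPerm L} (hπ : ∀ a ∈ s.supp ∪ t.supp, π.onNom a ∉ F) {ρ : Subst L}
    (hρ : ρ.Solves (s.val θ π) (t.val θ π)) :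
    ∃ ρ' : Subst L, ρ'.Solves s t ∧ ρ'.applySig S ⊆ ρ.applySig S' ∧
      ∀ B B' B₁ B₂ : Fm L, B.fvars ⊆ S → IsVal F θ B B' → ρ.NCAS B' B₂ → ρ'.NCAS B B₁ →
        PermEq B₂ B₁ := by
  classical
  rw [Subst.solves_iff] at hρ
  obtain ⟨π₂, hπ₂, hna⟩ := hρ
  -- κ agrees with π₂ where the solved instance can see it. The other constants of F must be moved
  -- away from ρ as well, since they can enter the remaining formulas of the sequent through θ.
  obtain ⟨κ, hκ, hκ'⟩ := π₂.exists_fresh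
    ((s.val θ π).finite_supp.union (t.val θ π).finite_supp)
    (hθ.finite_supp.union ((s.finite_supp.union t.finite_supp).image π.onNom)) ρ.finite_supp
  have hκρ : ∀ a ∈ F ∪ π.onNom '' (s.supp ∪ t.supp), κ.onNom a ∉ ρ.supp := by
    intro a ha
    by_cases h : a ∈ (s.val θ π).supp ∪ (t.val θ π).supp
    · rw [hκ a h]
      exact hπ₂ a h
    · exact hκ' a ha h
  let ρ' : Subst L :=
    { toFun := fun τ x => if (⟨τ, x⟩ : L.Var) ∈ S then (θ τ x).val ρ.toFun κ else .var x
      finite_dom := hS.subset fun x hx => by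
        by_contra h
        exact hx (if_neg h) }
  have hρS : ∀ x ∈ S, ρ'.toFun x.1 x.2 = (θ x.1 x.2).val ρ.toFun κ := fun x hx => if_pos hx
  have hdom : ρ'.dom ⊆ S := fun x hx => by
    by_contra h
    exact hx (if_neg h)
  have hsupp : ρ'.supp ⊆ κ.onNom '' F ∪ ρ.supp := by
    rintro a ⟨x, hx, ha⟩
    rw [hρS x (hdom hx)] at ha
    exact Term.supp_val_subset _ (fun y _ => (ρ.supp_subset y).trans Set.subset_union_right)
      (fun b hb => .inl (Set.mem_image_of_mem _ (hθ.supp_subset x (hdom hx) hb))) ha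
  refine ⟨ρ', ?_, ?_, ?_⟩
  · rw [Subst.solves_iff]
    refine ⟨κ.comp π, fun a ha h => ?_, ?_⟩
    · rcases hsupp h with ⟨b, hb, hab⟩ | h
      · exact hπ a ha (κ.onNom_injective (a₁ := b) (a₂ := π.onNom a) hab ▸ hb)
      · exact hκρ (π.onNom a) (.inr (Set.mem_image_of_mem _ ha)) h
    · have key : ∀ {τ : L.Ty} (r : Term L τ), r.fvars ⊆ S →
          (r.val θ π).supp ⊆ (s.val θ π).supp ∪ (t.val θ π).supp →
          r.val ρ'.toFun (κ.comp π) = (r.val θ π).val ρ.toFun π₂ := by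
        intro τ r hr hr'
        rw [← Term.val_congr (θ := ρ.toFun) (π := κ) (r.val θ π) (fun _ _ => rfl)
          fun a ha => hκ a (hr' ha), Term.val_val]
        exact Term.val_congr r (fun x hx => hρS x (hr hx)) fun _ _ => rfl
      rw [key s hs Set.subset_union_left, key t ht Set.subset_union_right]
      exact hna
  · refine ρ'.applySig_subset hdom fun x hx => ?_
    rw [hρS x hx]
    exact Term.fvars_val_subset _ fun y hy =>
      ρ.fvars_subset_applySig (hθ.fvars_subset x hx hy)
  · intro B B' B₁ B₂ hB hB' h₂ h₁
    rw [Subst.ncas_iff] at h₁ h₂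
    obtain ⟨υ, hυ, rfl⟩ := hB'
    -- μ agrees with κ on the constants of θ and moves those coming from B away from ρ. Then
    -- (μ.B')[ρ] is both a value of B' under ρ and, by μ ∘ υ, a value of B under ρ'; uniqueness up
    -- to ≈ links it to B₂ and to B₁.
    obtain ⟨μ, hμ, hμ'⟩ := κ.exists_fresh hθ.finite_supp (B.finite_supp.image υ.onNom)
      ρ.finite_supp
    have h₃ : IsVal ρ.supp ρ.toFun (B.val θ υ) ((B.val θ υ).val ρ.toFun μ) := by
      refine ⟨μ, fun a ha => ?_, rfl⟩
      by_cases haF : a ∈ F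
      · rw [hμ a haF]
        exact hκρ a (.inl haF)
      · have := Term.supp_val_subset (A := F ∪ υ.onNom '' B.supp) B
          (fun x hx => (hθ.supp_subset x (hB hx)).trans Set.subset_union_left)
          (fun b hb => .inr ⟨b, hb, rfl⟩) ha
        exact hμ' a (this.resolve_left haF) haF
    have h₄ : IsVal ρ'.supp ρ'.toFun B ((B.val θ υ).val ρ.toFun μ) := by
      refine ⟨μ.comp υ, fun a ha h => ?_, ?_⟩
      · rcases hsupp h with ⟨b, hb, hab⟩ | h
        · rw [← hμ b hb] at hab
          exact hυ a ha (μ.onNom_injective (a₁ := b) (a₂ := υ.onNom a) hab ▸ hb)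
        · exact hμ' _ ⟨a, ha, rfl⟩ (hυ a ha) h
      · rw [Term.val_val]
        refine Term.val_congr B (fun x hx => ?_) fun _ _ => rfl
        rw [hρS x (hB hx)]
        exact Term.val_congr _ (fun _ _ => rfl) fun a ha => hμ a (hθ.supp_subset x (hB hx) ha)
    exact (IsVal.permEq ρ.finite_supp (fun x _ => ρ.supp_subset x) h₃ h₂).trans
      (IsVal.permEq ρ'.finite_supp (fun x _ => ρ'.supp_subset x) h₁ h₄)

/-! ## Substitution in derivations -/

theorem Deriv.one_le_ht {L : Lang} {D : Definition L} {q : Sequent L} (P : Deriv D q) :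
    1 ≤ P.ht := by
  cases P with
  | @node _ I prem wf r sub =>
    rw [Deriv.ht]
    split_ifs with h
    · exact le_rfl
    · obtain ⟨i⟩ := not_isEmpty_iff.1 h
      exact le_trans le_add_self (Ordinal.le_iSup (fun i => (sub i).ht + 1) i)

/-- Each new premise is charged to an old one of at least its height; no bijection of premises is
required. If there are no new premises, the height is 1, which is a lower bound for all heights. -/
theorem Deriv.exists_node {L : Lang} {D : Definition L} {q : Sequent L} {I : Type}
    {prem : I → Sequent L} (wf : q.WF) (r : Rule D prem q) (sub : ∀ i, Deriv D (prem i))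
    {q' : Sequent L} {I' : Type} {prem' : I' → Sequent L} (wf' : q'.WF) (r' : Rule D prem' q')
    (h : ∀ i', ∃ i, ∃ P : Deriv D (prem' i'), P.ht ≤ (sub i).ht) :
    ∃ P : Deriv D q', P.ht ≤ (Deriv.node prem wf r sub).ht := by
  choose f sub' hsub using h
  refine ⟨.node prem' wf' r' sub', ?_⟩
  by_cases hI : IsEmpty I'
  · refine le_of_eq_of_le ?_ (Deriv.one_le_ht _)
    rw [Deriv.ht, if_pos hI]
  · have hI' : ¬ IsEmpty I := fun h => hI ⟨fun i => h.elim (f i)⟩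
    rw [Deriv.ht, Deriv.ht, if_neg hI, if_neg hI']
    refine Ordinal.iSup_le fun i => ?_
    exact le_trans (add_le_add_left (hsub i) 1) (Ordinal.le_iSup (fun i => (sub i).ht + 1) (f i))

/-- The bounds F and S' need not be attained. This slack is what lets a single induction also cover
passage to ≈-variants and growth of the signature, both needed for ⊵L. -/
theorem Deriv.exists_val {L : Lang} {D : Definition L} {q : Sequent L} (P : Deriv D q) :
    ∀ (θ : ∀ τ : L.Ty, EVar τ → Term L τ) (F : Set L.Nominal) (S' : Set L.Var)
      (Γ' : Multiset (Fm L)) (C' : Fm L), MapsSig q.sig θ F S' →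
      Multiset.Rel (IsVal F θ) q.hyps Γ' → IsVal F θ q.concl C' →
      ∃ P' : Deriv D ⟨S', Γ', C'⟩, P'.ht ≤ P.ht := by
  induction P with
  | @node q I prem wf r sub ih =>
    intro θ F S' Γ' C' hθ hΓ hC
    have wf' := wf.map hθ hΓ hC
    have build := fun {q' : Sequent L} {I' : Type} {prem' : I' → Sequent L} =>
      Deriv.exists_node (q' := q') (I' := I') (prem' := prem') wf r sub
    have value := fun B : Fm L => IsVal.exists hθ.finite_supp θ B
    generalize (Deriv.node prem wf r sub).ht = κ at build ⊢
    cases r with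
    | id S Γ B B' h =>
      obtain ⟨X, Γ', hB, hΓ₁, rfl⟩ := Multiset.rel_cons_left.1 hΓ
      refine build wf' (.id S' Γ' X C' ?_) fun i => i.elim0
      -- A value of B is also a value of B' because B ≈ B', and any two values of B' agree up to ≈.
      exact IsVal.permEq hθ.finite_supp (fun x hx =>
        hθ.supp_subset x (wf.concl_fvars hx)) hC (hB.of_permEq h)
    | cut S Γ Δ B C =>
      obtain ⟨Γ', Δ', hΓ₁, hΔ, rfl⟩ := Multiset.rel_add_left.1 hΓ
      -- Any value of the cut formula will do, provided that both premises use the same one.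
      obtain ⟨B', hB⟩ := value B
      exact build wf' (.cut S' Γ' Δ' B' C') (Fin.forall_fin_two.2
        ⟨⟨0, ih 0 θ F S' _ _ hθ hΓ₁ hB⟩, ⟨1, ih 1 θ F S' _ _ hθ (.cons hB hΔ) hC⟩⟩)
    | contrL S Γ B C =>
      obtain ⟨X, Γ', hB, hΓ₁, rfl⟩ := Multiset.rel_cons_left.1 hΓ
      exact build wf' (.contrL S' Γ' X C')
        (Fin.forall_fin_one.2 ⟨0, ih 0 θ F S' _ _ hθ (.cons hB (.cons hB hΓ₁)) hC⟩)
    | botL S Γ C =>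
      obtain ⟨X, Γ', ⟨π, hπ, rfl⟩, hΓ₁, rfl⟩ := Multiset.rel_cons_left.1 hΓ
      exact build wf' (.botL S' Γ' C') fun i => i.elim0
    | topR S Γ =>
      obtain ⟨π, hπ, rfl⟩ := hC
      exact build wf' (.topR S' Γ') fun i => i.elim0
    | orL S Γ A B C =>
      obtain ⟨X, Γ', hX, hΓ₁, rfl⟩ := Multiset.rel_cons_left.1 hΓ
      obtain ⟨A', B', rfl, hA, hB⟩ := IsVal.of_const_app₂ hX
      exact build wf' (.orL S' Γ' A' B' C') (Fin.forall_fin_two.2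
        ⟨⟨0, ih 0 θ F S' _ _ hθ (.cons hA hΓ₁) hC⟩, ⟨1, ih 1 θ F S' _ _ hθ (.cons hB hΓ₁) hC⟩⟩)
    | orR₁ S Γ A B =>
      obtain ⟨A', B', rfl, hA, hB⟩ := IsVal.of_const_app₂ hC
      exact build wf' (.orR₁ S' Γ' A' B') (Fin.forall_fin_one.2 ⟨0, ih 0 θ F S' _ _ hθ hΓ hA⟩)
    | orR₂ S Γ A B =>
      obtain ⟨A', B', rfl, hA, hB⟩ := IsVal.of_const_app₂ hC
      exact build wf' (.orR₂ S' Γ' A' B') (Fin.forall_fin_one.2 ⟨0, ih 0 θ F S' _ _ hθ hΓ hB⟩)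
    | andL₁ S Γ A B C =>
      obtain ⟨X, Γ', hX, hΓ₁, rfl⟩ := Multiset.rel_cons_left.1 hΓ
      obtain ⟨A', B', rfl, hA, hB⟩ := IsVal.of_const_app₂ hX
      exact build wf' (.andL₁ S' Γ' A' B' C')
        (Fin.forall_fin_one.2 ⟨0, ih 0 θ F S' _ _ hθ (.cons hA hΓ₁) hC⟩)
    | andL₂ S Γ A B C =>
      obtain ⟨X, Γ', hX, hΓ₁, rfl⟩ := Multiset.rel_cons_left.1 hΓ
      obtain ⟨A', B', rfl, hA, hB⟩ := IsVal.of_const_app₂ hX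
      exact build wf' (.andL₂ S' Γ' A' B' C')
        (Fin.forall_fin_one.2 ⟨0, ih 0 θ F S' _ _ hθ (.cons hB hΓ₁) hC⟩)
    | andR S Γ A B =>
      obtain ⟨A', B', rfl, hA, hB⟩ := IsVal.of_const_app₂ hC
      exact build wf' (.andR S' Γ' A' B') (Fin.forall_fin_two.2
        ⟨⟨0, ih 0 θ F S' _ _ hθ hΓ hA⟩, ⟨1, ih 1 θ F S' _ _ hθ hΓ hB⟩⟩)
    | impL S Γ A B C =>
      obtain ⟨X, Γ', hX, hΓ₁, rfl⟩ := Multiset.rel_cons_left.1 hΓ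
      obtain ⟨A', B', rfl, hA, hB⟩ := IsVal.of_const_app₂ hX
      exact build wf' (.impL S' Γ' A' B' C') (Fin.forall_fin_two.2
        ⟨⟨0, ih 0 θ F S' _ _ hθ hΓ₁ hA⟩, ⟨1, ih 1 θ F S' _ _ hθ (.cons hB hΓ₁) hC⟩⟩)
    | impR S Γ A B =>
      obtain ⟨A', B', rfl, hA, hB⟩ := IsVal.of_const_app₂ hC
      exact build wf' (.impR S' Γ' A' B')
        (Fin.forall_fin_one.2 ⟨0, ih 0 θ F S' _ _ hθ (.cons hA hΓ) hB⟩)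
    | allL S Γ hτ B C t ht =>
      obtain ⟨X, Γ', hX, hΓ₁, rfl⟩ := Multiset.rel_cons_left.1 hΓ
      obtain ⟨π, hπ, rfl⟩ := IsVal.of_const_app hX
      obtain ⟨t', ht', hBt⟩ := exists_instance hθ hπ ht
      exact build wf' (.allL S' Γ' hτ _ C' t' ht')
        (Fin.forall_fin_one.2 ⟨0, ih 0 θ F S' _ _ hθ (.cons hBt hΓ₁) hC⟩)
    | allR S Γ hτ B c hc h hh =>
      obtain ⟨π, hπ, rfl⟩ := IsVal.of_const_app hC
      have hB : B.fvars ⊆ S := (fvars_const_app _ B).symm.trans_subset wf.concl_fvars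
      obtain ⟨cs', c', h', θ', hc', hh', hθ', agree, hBh⟩ := exists_raise hθ hτ hB hc hh hπ
      -- The context has its free variables in S, where the extended substitution agrees with θ, so
      -- its values are unchanged.
      exact build wf' (.allR S' Γ' hτ _ c' hc' h' hh') (Fin.forall_fin_one.2
        ⟨0, ih 0 θ' F _ _ _ hθ' (hΓ.mono fun A hA X _ hX => hX.congr fun x hx =>
          agree x (wf.hyps_fvars A hA hx)) hBh⟩)
    | nabL S Γ hτ B C a ha =>
      obtain ⟨X, Γ', hX, hΓ₁, rfl⟩ := Multiset.rel_cons_left.1 hΓ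
      obtain ⟨π, hπ, rfl⟩ := IsVal.of_const_app hX
      obtain ⟨a', ha', hBa⟩ := exists_fresh_instance hθ.finite_supp hπ ha
      exact build wf' (.nabL S' Γ' hτ _ C' a' ha')
        (Fin.forall_fin_one.2 ⟨0, ih 0 θ F S' _ _ hθ (.cons hBa hΓ₁) hC⟩)
    | nabR S Γ hτ B a ha =>
      obtain ⟨π, hπ, rfl⟩ := IsVal.of_const_app hC
      obtain ⟨a', ha', hBa⟩ := exists_fresh_instance hθ.finite_supp hπ ha
      exact build wf' (.nabR S' Γ' hτ _ a' ha')
        (Fin.forall_fin_one.2 ⟨0, ih 0 θ F S' _ _ hθ hΓ hBa⟩)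
    | exL S Γ hτ B C c hc h hh =>
      obtain ⟨X, Γ', hX, hΓ₁, rfl⟩ := Multiset.rel_cons_left.1 hΓ
      obtain ⟨π, hπ, rfl⟩ := IsVal.of_const_app hX
      have hB : B.fvars ⊆ S :=
        (fvars_const_app _ B).symm.trans_subset (wf.hyps_fvars _ (Multiset.mem_cons_self _ _))
      obtain ⟨cs', c', h', θ', hc', hh', hθ', agree, hBh⟩ := exists_raise hθ hτ hB hc hh hπ
      exact build wf' (.exL S' Γ' hτ _ C' c' hc' h' hh') (Fin.forall_fin_one.2
        ⟨0, ih 0 θ' F _ _ _ hθ' (.cons hBh (hΓ₁.mono fun A hA X _ hX => hX.congr fun x hx =>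
          agree x (wf.hyps_fvars A (Multiset.mem_cons_of_mem hA) hx)))
          (hC.congr fun x hx => agree x (wf.concl_fvars hx))⟩)
    | exR S Γ hτ B t ht =>
      obtain ⟨π, hπ, rfl⟩ := IsVal.of_const_app hC
      obtain ⟨t', ht', hBt⟩ := exists_instance hθ hπ ht
      exact build wf' (.exR S' Γ' hτ _ t' ht')
        (Fin.forall_fin_one.2 ⟨0, ih 0 θ F S' _ _ hθ hΓ hBt⟩)
    | naL S Γ hn s t C G E hG hE =>
      obtain ⟨X, Γ', hX, hΓ₁, rfl⟩ := Multiset.rel_cons_left.1 hΓ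
      obtain ⟨π, hπ, rfl⟩ := IsVal.of_fNa hX
      have hst : s.fvars ∪ t.fvars ⊆ S := (fvars_const_app₂ _ s t).symm.trans_subset
        (wf.hyps_fvars _ (Multiset.mem_cons_self _ _))
      rw [Set.union_subset_iff] at hst
      choose ρ' hρ' hsig hval using fun ρ : {ρ : Subst L // ρ.Solves (s.val θ π) (t.val θ π)} =>
        ρ.2.exists_of_val wf.sig_finite hθ hst.1 hst.2 hπ
      choose G' hG' using fun ρ : {ρ : Subst L // ρ.Solves (s.val θ π) (t.val θ π)} =>
        rel_exists_right (r := ρ.1.NCAS) (fun B => by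
          rw [Subst.ncas_eq]; exact IsVal.exists ρ.1.finite_supp _ B) Γ'
      choose E' hE' using fun ρ : {ρ : Subst L // ρ.Solves (s.val θ π) (t.val θ π)} =>
        show ∃ E', ρ.1.NCAS C' E' by
          rw [Subst.ncas_eq]; exact IsVal.exists ρ.1.finite_supp _ C'
      -- The premise for ρ is charged to the old premise for ρ'.
      refine build wf' (.naL S' Γ' hn _ _ C' G' E' hG' hE') fun ρ => ⟨⟨ρ' ρ, hρ' ρ⟩, ?_⟩
      -- The identity with F = ∅ passes to ≈-variants, while the signature grows from the one of ρ'
      -- to the one of ρ.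
      refine ih ⟨ρ' ρ, hρ' ρ⟩ (fun _ x => .var x) ∅ _ _ _ ⟨Set.finite_empty,
        ρ.1.finite_applySig hθ.finite_sig, fun x _ => by simp [Term.supp_var], fun x hx => ?_⟩ ?_ ?_
      · rw [Term.fvars_var]
        exact Set.singleton_subset_iff.2 (hsig ρ hx)
      -- The values under ρ' are traced back to Γ, then forward through Γ' to the values under ρ;
      -- formula by formula the ends agree up to ≈.
      · refine rel_comp (rel_comp (Multiset.rel_flip.2 (hG ⟨ρ' ρ, hρ' ρ⟩)) hΓ₁
          (q := fun B₁ B' => ∃ B : Fm L, B.fvars ⊆ S ∧ IsVal F θ B B' ∧ (ρ' ρ).NCAS B B₁)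
          fun B₁ B hB B' h₁ h₂ => ⟨B, wf.hyps_fvars B (Multiset.mem_cons_of_mem hB), h₂, h₁⟩)
          (hG' ρ) ?_
        rintro B₁ B' - B₂ ⟨B, hB, h₁, h₂⟩ h₃
        exact permEq_iff.1 (hval ρ B B' B₁ B₂ hB h₁ h₃ h₂)
      · exact permEq_iff.1 (hval ρ C C' _ _ wf.concl_fvars hC (hE' ρ) (hE ⟨ρ' ρ, hρ' ρ⟩))
    | naR S Γ hn s t h =>
      obtain ⟨π, hπ, rfl⟩ := IsVal.of_fNa hC
      have hst : s.fvars ∪ t.fvars ⊆ S := (fvars_const_app₂ _ s t).symm.trans_subset wf.concl_fvars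
      exact build wf' (.naR S' Γ' hn _ _ (h.val hθ.finite_supp
        (fun x hx => hθ.supp_subset x (hst (.inr hx))) hπ)) fun i => i.elim0
    | defL S Γ p cl hcl us C =>
      obtain ⟨X, Γ', hX, hΓ₁, rfl⟩ := Multiset.rel_cons_left.1 hΓ
      obtain ⟨us', rfl, hus⟩ := IsVal.of_fAtom hX
      exact build wf' (.defL S' Γ' p cl hcl us' C') (Fin.forall_fin_one.2
        ⟨0, ih 0 θ F S' _ _ hθ (.cons (hus _ (cl.fvars_body_app p) (cl.supp_body_app p)) hΓ₁) hC⟩)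
    | defR S Γ p cl hcl us =>
      obtain ⟨us', rfl, hus⟩ := IsVal.of_fAtom hC
      exact build wf' (.defR S' Γ' p cl hcl us') (Fin.forall_fin_one.2
        ⟨0, ih 0 θ F S' _ _ hθ hΓ (hus _ (cl.fvars_body_app p) (cl.supp_body_app p))⟩)
    | indL S Γ p cl hcl hmu us C V hVc hVn xs hxs =>
      obtain ⟨X, Γ', hX, hΓ₁, rfl⟩ := Multiset.rel_cons_left.1 hΓ
      obtain ⟨us', rfl, hus⟩ := IsVal.of_fAtom hX
      -- The premise on the invariant does not involve Σ, Γ or t⃗, so its derivation is reused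
      -- unchanged; likewise for co-induction.
      exact build wf' (.indL S' Γ' p cl hcl hmu us' C' V hVc hVn xs hxs) (Fin.forall_fin_two.2
        ⟨⟨0, sub 0, le_rfl⟩, ⟨1, ih 1 θ F S' _ _ hθ (.cons (hus V hVc hVn) hΓ₁) hC⟩⟩)
    | coindR S Γ p cl hcl hnu us V hVc hVn xs hxs =>
      obtain ⟨us', rfl, hus⟩ := IsVal.of_fAtom hC
      exact build wf' (.coindR S' Γ' p cl hcl hnu us' V hVc hVn xs hxs) (Fin.forall_fin_two.2
        ⟨⟨0, ih 0 θ F S' _ _ hθ hΓ (hus V hVc hVn)⟩, ⟨1, sub 1, le_rfl⟩⟩)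

end NomAbs

/-! ### The lemma for finite substitutions -/

open NomAbs
theorem mainTheorem3 (L : Lang) (D : Definition L) (S : Set L.Var) (Γ : Multiset (Fm L)) (C : Fm L)
    (P : Deriv D ⟨S, Γ, C⟩) (θ : Subst L) :
    (∃ (Γ' : Multiset (Fm L)) (C' : Fm L), θ.NCASs Γ Γ' ∧ θ.NCAS C C') ∧
    ∀ (Γ' : Multiset (Fm L)) (C' : Fm L), θ.NCASs Γ Γ' → θ.NCAS C C' →
      ∃ P' : Deriv D ⟨θ.applySig S, Γ', C'⟩, P'.ht ≤ P.ht := by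
  have wf : Sequent.WF ⟨S, Γ, C⟩ := by
    cases P with
    | node _ wf _ _ => exact wf
  have value : ∀ B : Fm L, ∃ B', θ.NCAS B B' := fun B => by
    rw [Subst.ncas_eq]
    exact IsVal.exists θ.finite_supp _ B
  refine ⟨?_, fun Γ' C' hΓ hC => ?_⟩
  · obtain ⟨Γ', hΓ⟩ := rel_exists_right value Γ
    obtain ⟨C', hC⟩ := value C
    exact ⟨Γ', C', hΓ, hC⟩
  · rw [Subst.NCASs, Subst.ncas_eq] at hΓ
    rw [Subst.ncas_eq] at hC
    exact P.exists_val θ.toFun θ.supp _ Γ' C' (θ.mapsSig wf.sig_finite) hΓ hC
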